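/- Let $K$ be a non-Archimedean local field (a non-discrete, totally disconnected, locally compact field) with canonical absolute value $|\cdot|$ (the factor by which multiplication scales Haar measure), ring of integers $O$ and maximal ideal $P=\beta O$, where $\beta$ is a uniformizer. Let $q$ be the number of elements of $O/P$, let $S\subset O$ be a complete set of representatives for $O/P$, and put $B_r=\beta^{-r}O$ for $r\in\mathbf Z$. Let $\chi$ be a rank zero character of $K$, i.e. a continuous unitary additive character such that $0$ is the largest integer $r$ with $\chi|_{B_r}\equiv 1$. Fix real numbers $\alpha>0$ and $t>0$ and an integer $n>0$, and let $$X_n=\Big\{\sum_{i=-n}^{n-1}a_i\beta^i : a_i\in S\Big\}$$ be the canonical set of representatives for the group $B_n/B_{-n}$, with the group structure carried over from $B_n/B_{-n}$. Assume that $0\in X_n$ (this holds in particular if $0\in S$). For $s\ge 0$ and $x\in X_n$ put $$p_{s,n}(x)=q^{-n}\sum_{y\in X_n}e^{-s|y|^\alpha}\chi(xy).$$ Let $D[0,t]$ be the space of functions $\omega:[0,t]\to K$ that are right-continuous on $[0,t)$, have left limits on $(0,t]$ and satisfy $\omega(t)=\omega(t-0)$, equipped with the Borel sets of the Skorokhod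 topology. For $a\in X_n$ let $\mathbf P_a^n$ denote the probability measure on $D[0,t]$ such that, for all $N$, all $0\le t_1<\dots<t_N\le t$ and all Borel sets $J_1,\dots,J_N\subset K$, $$\mathbf P_a^n(\omega(t_i)\in J_i,\ 1\le i\le N)=\sum_{b_i\in J_i\cap X_n,\ 1\le i\le N}p_{t_1,n}(b_1-a)\,p_{t_2-t_1,n}(b_2-b_1)\cdots p_{t_N-t_{N-1},n}(b_N-b_{N-1})\,q^{-nN}.$$ Theorem. For each $a\in X_n$ such a probability measure $\mathbf P_a^n$ exists, and (every) such measure gives full measure to the paths on the grid, that is, $$\mathbf P_a^n\big(\omega : \omega(s)\in X_n\ \text{for all } s\in[0,t]\big)=1 .$$ -/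

import Mathlib

open scoped ValuativeRel Topology MeasureTheory

noncomputable section

namespace LocalFieldWalk

section Field

variable (K : Type*) [Field K] [ValuativeRel K] [TopologicalSpace K]
  [IsNonarchimedeanLocalField K]

/-- The number `q` of elements of the residue field `O/P`. -/
def resCard : ℕ := Nat.card 𝓀[K]

variable {K}

/-- The canonical absolute value: `|x|` is the factor by which multiplication by `x` scales
Haar measure on `K`, and `|0| = 0`. -/
def canonAbs (x : K) : ℝ :=
  open Classical in
  if h : x = 0 then 0 else (MeasureTheory.distribHaarChar K (Units.mk0 x h) : ℝ)

/-- `β` is a uniformizer: `P = βO`. -/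
def IsUniformizer (β : 𝒪[K]) : Prop := 𝓂[K] = Ideal.span {β}

/-- `S` is a complete set of representatives for the residue classes in `O/P`. -/
def IsRepSystem (S : Finset 𝒪[K]) : Prop :=
  Set.BijOn (IsLocalRing.residue 𝒪[K]) (S : Set 𝒪[K]) Set.univ

/-- The ball `B_r = β^{-r} O` (of radius `q^r`). -/
def ball (β : 𝒪[K]) (r : ℤ) : Set K := {x | ∃ y : 𝒪[K], x = (β : K) ^ (-r) * (y : K)}

/-- `χ` is a (continuous, unitary) additive character of `K` of rank zero: the largest integer `r`
with `χ = 1` on `B_r` is `0`. -/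
def IsRankZeroChar (β : 𝒪[K]) (χ : AddChar K Circle) : Prop :=
  Continuous χ ∧ IsGreatest {r : ℤ | ∀ x ∈ ball β r, χ x = 1} 0

/-- The grid `X_n`: all sums `a_{-n} β^{-n} + ⋯ + a_{n-1} β^{n-1}` with `a_i ∈ S`. -/
def grid (β : 𝒪[K]) (S : Finset 𝒪[K]) (n : ℕ) : Finset K :=
  open Classical in
  (Fintype.piFinset fun _ : Fin (2 * n) => S).image
    fun c => ∑ j : Fin (2 * n), (c j : K) * (β : K) ^ ((j : ℤ) - (n : ℤ))

/-- The inverse finite Fourier transform `q^{-n} ∑_{y ∈ X_n} f(y) χ(xy)`. It is written for all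
`x : K`; see `invFourier_add`. -/
def invFourier (β : 𝒪[K]) (S : Finset 𝒪[K]) (χ : AddChar K Circle) (n : ℕ) (f : K → ℂ) (x : K) :
    ℂ :=
  ((resCard K : ℂ) ^ n)⁻¹ * ∑ y ∈ grid β S n, f y * (χ (x * y) : ℂ)

/-- The density `p_{s,n}`, the inverse finite Fourier transform of `e^{-s|·|^α}`. -/
def density (β : 𝒪[K]) (S : Finset 𝒪[K]) (χ : AddChar K Circle) (α : ℝ) (n : ℕ) (s : ℝ) (x : K) :
    ℂ :=
  invFourier β S χ n (fun y => (Real.exp (-s * canonAbs y ^ α) : ℂ)) x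

/-- Inverse finite Fourier transforms are invariant under `H_n = B_{-n}`. Hence the value at the
difference of two grid points is the same whether that difference is taken in `K` or
in `X_n`, with the group structure carried over from `B_n / H_n`. -/
theorem invFourier_add {β : 𝒪[K]} (hβ : IsUniformizer β) (S : Finset 𝒪[K])
    {χ : AddChar K Circle} (hχ : IsRankZeroChar β χ) (n : ℕ) (f : K → ℂ) (x h : K)
    (hh : h ∈ ball β (-(n : ℤ))) :
    invFourier β S χ n f (x + h) = invFourier β S χ n f x := by
  classical
  have hβ0 : (β : K) ≠ 0 := by
    intro h0
    have h1 : β = 0 := Subtype.ext h0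
    have h2 : 𝓂[K] = ⊥ := by
      rw [IsUniformizer, h1] at hβ
      simpa using hβ
    exact IsDiscreteValuationRing.not_a_field 𝒪[K] h2
  unfold invFourier
  congr 1
  refine Finset.sum_congr rfl fun y hy => ?_
  have key : χ (h * y) = 1 := by
    obtain ⟨c, -, rfl⟩ := Finset.mem_image.1 hy
    obtain ⟨o, rfl⟩ := hh
    refine hχ.2.1 _ ⟨∑ j : Fin (2 * n), c j * β ^ (j : ℕ) * o, ?_⟩
    push_cast
    rw [Finset.mul_sum, neg_zero, zpow_zero, one_mul]
    refine Finset.sum_congr rfl fun j _ => ?_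
    rw [zpow_sub₀ hβ0, neg_neg, zpow_natCast, zpow_natCast]
    have := pow_ne_zero n hβ0
    field_simp
  rw [add_mul, AddChar.map_add_eq_mul, key, mul_one]

variable (K)

/-- The space `D[0,t]` of Skorokhod functions `[0,t] → K`. One-sided limits are taken within
`[0,t]`, so that the conditions on the right of `t` and on the left of `0` are void. -/
structure SkorokhodSpace (t : ℝ) where
  /-- the path -/
  path : Set.Icc (0 : ℝ) t → K
  rightCont : ∀ s, Filter.Tendsto path (𝓝[>] s) (𝓝 (path s))
  leftLim : ∀ s, ∃ l, Filter.Tendsto path (𝓝[<] s) (𝓝 l)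
  leftContEnd : ∀ s : Set.Icc (0 : ℝ) t, (s : ℝ) = t →
    Filter.Tendsto path (𝓝[<] s) (𝓝 (path s))

variable {K}

/-- `g` is within `ε` of `f` in the Skorokhod sense: after a time change `τ` (an increasing
bijection of `[0,t]`) that moves no time by `ε` or more, the paths are uniformly `ε`-close. -/
def SkorokhodNear {t : ℝ} (ε : ℝ) (f g : SkorokhodSpace K t) : Prop :=
  ∃ τ : Set.Icc (0 : ℝ) t ≃o Set.Icc (0 : ℝ) t,
    (∀ s, |(τ s : ℝ) - (s : ℝ)| < ε) ∧ ∀ s, canonAbs (f.path s - g.path (τ s)) < ε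

/-- The Skorokhod topology on `D[0,t]`. -/
instance (t : ℝ) : TopologicalSpace (SkorokhodSpace K t) where
  IsOpen U := ∀ f ∈ U, ∃ ε > 0, ∀ g, SkorokhodNear ε f g → g ∈ U
  isOpen_univ := fun _ _ => ⟨1, one_pos, fun _ _ => trivial⟩
  isOpen_inter := by
    rintro U V hU hV f ⟨hfU, hfV⟩
    obtain ⟨ε, hε, h⟩ := hU f hfU
    obtain ⟨δ, hδ, h'⟩ := hV f hfV
    refine ⟨min ε δ, lt_min hε hδ, fun g ⟨τ, h1, h2⟩ => ⟨h g ⟨τ, ?_, ?_⟩, h' g ⟨τ, ?_, ?_⟩⟩⟩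
    · exact fun s => (h1 s).trans_le (min_le_left _ _)
    · exact fun s => (h2 s).trans_le (min_le_left _ _)
    · exact fun s => (h1 s).trans_le (min_le_right _ _)
    · exact fun s => (h2 s).trans_le (min_le_right _ _)
  isOpen_sUnion := by
    rintro C hC f ⟨U, hU, hfU⟩
    obtain ⟨ε, hε, h⟩ := hC U hU f hfU
    exact ⟨ε, hε, fun g hg => ⟨U, hU, h g hg⟩⟩

/-- `D[0,t]` carries the Borel sets of the Skorokhod topology. -/
instance (t : ℝ) : MeasurableSpace (SkorokhodSpace K t) := borel _

instance (t : ℝ) : BorelSpace (SkorokhodSpace K t) := ⟨rfl⟩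

/-- The number `∑ p_{t_1,n}(b_1 - a) p_{t_2-t_1,n}(b_2 - b_1) ⋯ p_{t_N-t_{N-1},n}(b_N - b_{N-1}) q^{-nN}`,
summed over all `b_i ∈ J_i ∩ X_n`. -/
def cylinderMass (β : 𝒪[K]) (S : Finset 𝒪[K]) (χ : AddChar K Circle) (α : ℝ) (n : ℕ) (a : K)
    {N : ℕ} (τ : Fin N → ℝ) (J : Fin N → Set K) : ℂ :=
  open Classical in
  ∑ b ∈ (Fintype.piFinset fun _ : Fin N => grid β S n) with ∀ i, b i ∈ J i,
    (∏ i : Fin N, density β S χ α n (τ i - (Fin.cons 0 τ : Fin (N + 1) → ℝ) i.castSucc)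
      (b i - (Fin.cons a b : Fin (N + 1) → K) i.castSucc)) * ((resCard K : ℂ) ^ (n * N))⁻¹

/-- `P` is the measure `P_a^n`: a probability measure on the Borel sets of `D[0,t]` with the
prescribed values on cylinder sets. -/
structure IsGridWalkMeasure (β : 𝒪[K]) (S : Finset 𝒪[K]) (χ : AddChar K Circle) (α : ℝ) (n : ℕ)
    (a : K) {t : ℝ} (P : MeasureTheory.Measure (SkorokhodSpace K t)) : Prop where
  isProb : MeasureTheory.IsProbabilityMeasure P
  cylinder : ∀ (N : ℕ) (τ : Fin N → Set.Icc (0 : ℝ) t), StrictMono τ →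
    ∀ J : Fin N → Set K, (∀ i, MeasurableSet[borel K] (J i)) →
      ((P.real {ω | ∀ i, ω.path (τ i) ∈ J i} : ℝ) : ℂ) =
        cylinderMass β S χ α n a (fun i => (τ i : ℝ)) J

end Field

end LocalFieldWalk

end

/-
The transition densities `p_{s,n}` have Fourier transform `e^{-s|y|^α}` on the finite group
`B_n / B_{-n}`, so they belong to a Lévy process there. As `-|y|^α` is the sum over `z` of
`ν(z) (χ(-zy) - 1)` with non-negative jump rates `ν(z)`, this is the compound Poisson process: jumps
are drawn according to `ν`, at uniform times, and their number is Poisson distributed. Its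
increments then have the right Fourier transform by the exponential series, and Fourier inversion
on the grid gives the finite-dimensional distributions.

For the second assertion, the cylinder probabilities show that at each fixed time the path is almost
surely on the grid. This holds simultaneously for a countable dense set of times, hence for all
times, as the grid is closed and paths are right-continuous.
-/

noncomputable section

open Filter MeasureTheory

namespace LocalFieldWalk

section Field

variable {K : Type*} [Field K] [ValuativeRel K] [TopologicalSpace K]
  [IsNonarchimedeanLocalField K] {β : 𝒪[K]} {S : Finset 𝒪[K]} {χ : AddChar K Circle}

theorem IsUniformizer.ne_zero (hβ : IsUniformizer β) : β ≠ 0 := by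
  rintro rfl
  rw [IsUniformizer, Ideal.span_singleton_eq_bot.2 rfl] at hβ
  exact IsDiscreteValuationRing.not_a_field 𝒪[K] hβ

theorem IsUniformizer.coe_ne_zero (hβ : IsUniformizer β) : (β : K) ≠ 0 :=
  fun h => hβ.ne_zero (Subtype.ext h)

theorem mem_ball_iff (hβ : IsUniformizer β) {r : ℤ} {x : K} :
    x ∈ ball β r ↔ x * (β : K) ^ r ∈ 𝒪[K] := by
  have h := zpow_ne_zero r hβ.coe_ne_zero
  constructor
  · rintro ⟨y, rfl⟩
    rw [zpow_neg, mul_right_comm, inv_mul_cancel₀ h, one_mul]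
    exact y.2
  · intro hx
    refine ⟨⟨_, hx⟩, ?_⟩
    rw [zpow_neg]
    field_simp

/-- The ball `B_r` as an additive subgroup. -/
def ballSubgroup (hβ : IsUniformizer β) (r : ℤ) : AddSubgroup K where
  carrier := ball β r
  zero_mem' := by rw [mem_ball_iff hβ, zero_mul]; exact zero_mem _
  add_mem' {x y} hx hy := by
    rw [mem_ball_iff hβ] at *
    rw [add_mul]; exact add_mem hx hy
  neg_mem' {x} hx := by
    rw [mem_ball_iff hβ] at *
    rw [neg_mul]; exact neg_mem hx

theorem zero_mem_ball (hβ : IsUniformizer β) (r : ℤ) : (0 : K) ∈ ball β r :=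
  (ballSubgroup hβ r).zero_mem

theorem add_mem_ball (hβ : IsUniformizer β) {r : ℤ} {x y : K} (hx : x ∈ ball β r)
    (hy : y ∈ ball β r) : x + y ∈ ball β r :=
  (ballSubgroup hβ r).add_mem hx hy

theorem sub_mem_ball (hβ : IsUniformizer β) {r : ℤ} {x y : K} (hx : x ∈ ball β r)
    (hy : y ∈ ball β r) : x - y ∈ ball β r :=
  (ballSubgroup hβ r).sub_mem hx hy

theorem mul_mem_ball (hβ : IsUniformizer β) {r s : ℤ} {x y : K} (hx : x ∈ ball β r)
    (hy : y ∈ ball β s) : x * y ∈ ball β (r + s) := by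
  rw [mem_ball_iff hβ] at *
  rw [zpow_add₀ hβ.coe_ne_zero, mul_mul_mul_comm]
  exact mul_mem hx hy

theorem ball_mono (hβ : IsUniformizer β) {r s : ℤ} (h : r ≤ s) : ball β r ⊆ ball β s := by
  intro x hx
  rw [mem_ball_iff hβ] at *
  obtain ⟨k, rfl⟩ := Int.le.dest h
  rw [zpow_add₀ hβ.coe_ne_zero, ← mul_assoc, zpow_natCast]
  exact mul_mem hx (pow_mem β.2 k)

theorem ball_zero (hβ : IsUniformizer β) : ball β 0 = (𝒪[K] : Set K) := by
  ext x
  rw [mem_ball_iff hβ, zpow_zero, mul_one, SetLike.mem_coe]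

theorem mem_ball_neg_one_of_valuation_lt_one (hβ : IsUniformizer β) {x : K}
    (hx : ValuativeRel.valuation K x < 1) : x ∈ ball β (-1) := by
  have hmem : (⟨x, hx.le⟩ : 𝒪[K]) ∈ 𝓂[K] := by
    rw [IsLocalRing.mem_maximalIdeal, mem_nonunits_iff,
      Valuation.Integers.isUnit_iff_valuation_eq_one
        (Valuation.integer.integers (ValuativeRel.valuation K))]
    exact hx.ne
  rw [hβ, Ideal.mem_span_singleton] at hmem
  obtain ⟨y, hy⟩ := hmem
  exact ⟨y, by rw [neg_neg, zpow_one]; exact congrArg Subtype.val hy⟩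

theorem inv_mem_ball (hβ : IsUniformizer β) {r : ℤ} {y : K} (hy : y ∉ ball β r) :
    y⁻¹ ∈ ball β (-r - 1) := by
  rw [mem_ball_iff hβ, Valuation.mem_integer_iff, not_le] at hy
  have hlt : ValuativeRel.valuation K (y * (β : K) ^ r)⁻¹ < 1 := by
    rw [map_inv₀]
    exact inv_lt_one_of_one_lt₀ hy
  obtain ⟨o, ho⟩ := mem_ball_neg_one_of_valuation_lt_one hβ hlt
  have hβr := zpow_ne_zero r hβ.coe_ne_zero
  refine ⟨o, ?_⟩
  calc y⁻¹ = (β : K) ^ r * (y * (β : K) ^ r)⁻¹ := by field_simp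
    _ = (β : K) ^ (-(-r - 1)) * (o : K) := by
      rw [ho, ← mul_assoc, ← zpow_add₀ hβ.coe_ne_zero]
      congr 2
      ring

theorem ball_mem_nhds (hβ : IsUniformizer β) (r : ℤ) : ball β r ∈ 𝓝 (0 : K) := by
  have hr : ValuativeRel.valuation K ((β : K) ^ r) ≠ 0 :=
    (map_ne_zero _).2 (zpow_ne_zero _ hβ.coe_ne_zero)
  refine mem_of_superset
    ((IsValuativeTopology.hasBasis_nhds_zero' K).mem_of_mem (inv_ne_zero hr)) fun x hx => ?_
  rw [mem_ball_iff hβ, Valuation.mem_integer_iff, map_mul]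
  rw [Set.mem_ofPred_eq, ← one_div] at hx
  exact (le_div_iff₀ (zero_lt_iff.2 hr)).1 hx.le

theorem isClopen_ball (hβ : IsUniformizer β) (r : ℤ) : IsClopen (ball β r) := by
  have h : IsOpen (ballSubgroup hβ r : Set K) :=
    (ballSubgroup hβ r).isOpen_of_mem_nhds (g := 0) (ball_mem_nhds hβ r)
  exact ⟨(ballSubgroup hβ r).isClosed_of_isOpen h, h⟩

theorem canonAbs_zero : canonAbs (0 : K) = 0 := by simp only [canonAbs, dite_true]

theorem canonAbs_of_ne_zero {x : K} (hx : x ≠ 0) :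
    canonAbs x = (distribHaarChar K (Units.mk0 x hx) : ℝ) := by
  simp only [canonAbs, dif_neg hx]

theorem canonAbs_pos {x : K} (hx : x ≠ 0) : 0 < canonAbs x := by
  rw [canonAbs_of_ne_zero hx]
  exact_mod_cast distribHaarChar_pos

theorem canonAbs_nonneg (x : K) : 0 ≤ canonAbs x := by
  by_cases hx : x = 0
  · rw [hx, canonAbs_zero]
  · exact (canonAbs_pos hx).le

theorem canonAbs_mul (x y : K) : canonAbs (x * y) = canonAbs x * canonAbs y := by
  by_cases hx : x = 0
  · rw [hx, zero_mul, canonAbs_zero, zero_mul]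
  by_cases hy : y = 0
  · rw [hy, mul_zero, canonAbs_zero, mul_zero]
  rw [canonAbs_of_ne_zero hx, canonAbs_of_ne_zero hy, canonAbs_of_ne_zero (mul_ne_zero hx hy),
    Units.mk0_mul, map_mul, NNReal.coe_mul]

theorem canonAbs_one : canonAbs (1 : K) = 1 := by
  have h := canonAbs_mul (1 : K) 1
  rw [mul_one] at h
  exact (mul_eq_left₀ (canonAbs_pos one_ne_zero).ne').1 h.symm

theorem canonAbs_zpow (x : K) (r : ℤ) : canonAbs (x ^ r) = canonAbs x ^ r :=
  map_zpow₀ ({ toFun := canonAbs, map_zero' := canonAbs_zero, map_one' := canonAbs_one,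
               map_mul' := canonAbs_mul } : K →*₀ ℝ) x r

open scoped Pointwise in
theorem addHaar_real_smul [MeasurableSpace K] [BorelSpace K] {x : K} (hx : x ≠ 0) (s : Set K) :
    (Measure.addHaar : Measure K).real (x • s) =
      canonAbs x * (Measure.addHaar : Measure K).real s := by
  have h := distribHaarChar_mul (Measure.addHaar : Measure K) (Units.mk0 x hx) s
  rw [canonAbs_of_ne_zero hx, measureReal_def, measureReal_def, ← ENNReal.coe_toReal,
    ← ENNReal.toReal_mul, h]
  rfl

theorem addHaar_ball_zero_ne_top [MeasurableSpace K] [BorelSpace K] (hβ : IsUniformizer β) :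
    (Measure.addHaar : Measure K) (ball β 0) ≠ ⊤ := by
  rw [ball_zero hβ]
  exact (IsNonarchimedeanLocalField.isCompact_closedBall K 1).measure_ne_top

theorem addHaar_real_ball_zero_pos [MeasurableSpace K] [BorelSpace K] (hβ : IsUniformizer β) :
    0 < (Measure.addHaar : Measure K).real (ball β 0) :=
  ENNReal.toReal_pos (Measure.measure_pos_of_mem_nhds _ (ball_mem_nhds hβ 0)).ne'
    (addHaar_ball_zero_ne_top hβ)

open scoped Pointwise in
theorem canonAbs_le_one (hβ : IsUniformizer β) {x : K} (hx : x ∈ 𝒪[K]) : canonAbs x ≤ 1 := by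
  borelize K
  by_cases h0 : x = 0
  · rw [h0, canonAbs_zero]
    exact zero_le_one
  have hsub : x • ball β 0 ⊆ ball β 0 := by
    rw [ball_zero hβ]
    rintro _ ⟨y, hy, rfl⟩
    exact mul_mem hx hy
  have h := measureReal_mono hsub (addHaar_ball_zero_ne_top hβ)
  rw [addHaar_real_smul h0] at h
  exact le_of_mul_le_mul_right (h.trans_eq (one_mul _).symm) (addHaar_real_ball_zero_pos hβ)

theorem one_notMem_ball_neg_one (hβ : IsUniformizer β) : (1 : K) ∉ ball β (-1) := by
  rintro ⟨y, hy⟩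
  rw [neg_neg, zpow_one] at hy
  have h1 : (1 : 𝒪[K]) ∈ 𝓂[K] := by
    rw [hβ, Ideal.mem_span_singleton]
    exact ⟨y, Subtype.ext hy⟩
  exact (IsLocalRing.maximalIdeal.isMaximal 𝒪[K]).ne_top ((Ideal.eq_top_iff_one _).2 h1)

omit [TopologicalSpace K] [IsNonarchimedeanLocalField K] in
open scoped Pointwise in
theorem uniformizer_smul_ball_zero : (β : K) • ball β 0 = ball β (-1) := by
  ext x
  constructor
  · rintro ⟨_, ⟨y, rfl⟩, rfl⟩
    exact ⟨y, by simp⟩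
  · rintro ⟨y, rfl⟩
    exact ⟨y, ⟨y, by simp⟩, by simp⟩

open scoped Pointwise in
/-- `P` and `1 + P` are disjoint subsets of `O` of the same measure, so `2|β| ≤ 1`. -/
theorem canonAbs_uniformizer_lt_one (hβ : IsUniformizer β) : canonAbs (β : K) < 1 := by
  borelize K
  have hdisj : Disjoint (ball β (-1)) ((1 : K) +ᵥ ball β (-1)) := by
    rw [Set.disjoint_left]
    rintro _ hx ⟨y, hy, rfl⟩
    refine one_notMem_ball_neg_one hβ ?_
    simpa using sub_mem_ball hβ hx hy
  have hle := ball_mono hβ (show (-1 : ℤ) ≤ 0 by norm_num)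
  have hsub : ball β (-1) ∪ ((1 : K) +ᵥ ball β (-1)) ⊆ ball β 0 := by
    refine Set.union_subset hle ?_
    rintro _ ⟨y, hy, rfl⟩
    exact add_mem_ball hβ ⟨1, by simp⟩ (hle hy)
  have htop : (Measure.addHaar : Measure K) (ball β (-1)) ≠ ⊤ :=
    measure_ne_top_of_subset hle (addHaar_ball_zero_ne_top hβ)
  have h := measureReal_mono hsub (addHaar_ball_zero_ne_top hβ)
  rw [measureReal_union hdisj ((isClopen_ball hβ _).isOpen.measurableSet.const_vadd _) htop
    (by rwa [measure_vadd]), measureReal_def _ (_ +ᵥ _), measure_vadd, ← measureReal_def,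
    ← uniformizer_smul_ball_zero, addHaar_real_smul hβ.coe_ne_zero] at h
  nlinarith [addHaar_real_ball_zero_pos hβ]

theorem canonAbs_le_of_mem_ball (hβ : IsUniformizer β) {r : ℤ} {x : K} (hx : x ∈ ball β r) :
    canonAbs x ≤ canonAbs (β : K) ^ (-r) := by
  obtain ⟨y, rfl⟩ := hx
  rw [canonAbs_mul, canonAbs_zpow]
  exact mul_le_of_le_one_right (zpow_nonneg (canonAbs_nonneg _) _) (canonAbs_le_one hβ y.2)

theorem le_canonAbs_of_notMem_ball (hβ : IsUniformizer β) {r : ℤ} {x : K} (hx : x ∉ ball β r) :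
    canonAbs (β : K) ^ (-r - 1) ≤ canonAbs x := by
  have hx0 : x ≠ 0 := fun h => hx (h ▸ zero_mem_ball hβ r)
  have h := canonAbs_le_of_mem_ball hβ (inv_mem_ball hβ hx)
  rw [← zpow_neg_one, canonAbs_zpow, zpow_neg_one, zpow_neg] at h
  exact (inv_le_inv₀ (canonAbs_pos hx0) (zpow_pos (canonAbs_pos hβ.coe_ne_zero) _)).1 h

theorem canonAbs_eq_of_mem_sphere (hβ : IsUniformizer β) {r : ℤ} {x : K} (hx : x ∈ ball β r)
    (hx' : x ∉ ball β (r - 1)) : canonAbs x = canonAbs (β : K) ^ (-r) := by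
  refine le_antisymm (canonAbs_le_of_mem_ball hβ hx) ?_
  simpa using le_canonAbs_of_notMem_ball hβ hx'

theorem eq_zero_of_forall_mem_ball (hβ : IsUniformizer β) {x : K}
    (hx : ∀ k : ℕ, x ∈ ball β (-(k : ℤ))) : x = 0 := by
  by_contra h0
  obtain ⟨k, hk⟩ := exists_pow_lt_of_lt_one (canonAbs_pos h0) (canonAbs_uniformizer_lt_one hβ)
  have h := canonAbs_le_of_mem_ball hβ (hx k)
  rw [neg_neg, zpow_natCast] at h
  exact hk.not_ge h

theorem iInter_setOf_sub_mem_ball (hβ : IsUniformizer β) (b : K) :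
    ⋂ k : ℕ, {x | x - b ∈ ball β (-(k : ℤ))} = {b} := by
  ext x
  simp only [Set.mem_iInter, Set.mem_ofPred_eq, Set.mem_singleton_iff]
  refine ⟨fun h => sub_eq_zero.1 (eq_zero_of_forall_mem_ball hβ h), fun h k => ?_⟩
  rw [h, sub_self]
  exact zero_mem_ball hβ _

theorem t1Space_of_isUniformizer (hβ : IsUniformizer β) : T1Space K := by
  refine ⟨fun b => ?_⟩
  rw [← iInter_setOf_sub_mem_ball hβ]
  exact isClosed_iInter fun k => (isClopen_ball hβ _).isClosed.preimage (continuous_sub_right b)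

end Field

theorem sum_mul_pow_succ {R : Type*} [CommSemiring R] (b : R) {m : ℕ} (c : Fin (m + 1) → R) :
    ∑ j, c j * b ^ (j : ℕ) = c 0 + b * ∑ i : Fin m, c i.succ * b ^ (i : ℕ) := by
  rw [Fin.sum_univ_succ, Finset.mul_sum]
  simp only [Fin.val_zero, Fin.val_succ, pow_zero, mul_one]
  congr 1
  exact Finset.sum_congr rfl fun i _ => by ring

section Grid

variable {K : Type*} [Field K] [ValuativeRel K] {β : 𝒪[K]} {S : Finset 𝒪[K]}

theorem mem_grid {n : ℕ} {x : K} :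
    x ∈ grid β S n ↔ ∃ c : Fin (2 * n) → 𝒪[K], (∀ j, c j ∈ S) ∧
      ∑ j : Fin (2 * n), (c j : K) * (β : K) ^ ((j : ℤ) - (n : ℤ)) = x := by
  simp only [grid, Finset.mem_image, Fintype.mem_piFinset]

variable [TopologicalSpace K] [IsNonarchimedeanLocalField K]

theorem resCard_pos : 0 < resCard K := Nat.card_pos

theorem resCard_ne_zero : (resCard K : ℂ) ≠ 0 := Nat.cast_ne_zero.2 resCard_pos.ne'

theorem IsRepSystem.card_eq (hS : IsRepSystem S) : S.card = resCard K := by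
  have h := hS.ncard_eq
  rwa [Set.ncard_coe_finset, Set.ncard_univ] at h

theorem residue_eq_iff_dvd (hβ : IsUniformizer β) (x y : 𝒪[K]) :
    IsLocalRing.residue 𝒪[K] x = IsLocalRing.residue 𝒪[K] y ↔ β ∣ x - y := by
  rw [← sub_eq_zero, ← map_sub, IsLocalRing.residue_eq_zero_iff, hβ, Ideal.mem_span_singleton]

theorem exists_digits (hβ : IsUniformizer β) (hS : IsRepSystem S) (m : ℕ) (x : 𝒪[K]) :
    ∃ c : Fin m → 𝒪[K], (∀ j, c j ∈ S) ∧ β ^ m ∣ x - ∑ j, c j * β ^ (j : ℕ) := by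
  induction m generalizing x with
  | zero => exact ⟨Fin.elim0, fun j => j.elim0, by rw [pow_zero]; exact one_dvd _⟩
  | succ m ih =>
    obtain ⟨c₀, hc₀, hx⟩ := hS.surjOn (Set.mem_univ (IsLocalRing.residue 𝒪[K] x))
    obtain ⟨x', hx'⟩ := (residue_eq_iff_dvd hβ x c₀).1 hx.symm
    obtain ⟨c, hc, y, hy⟩ := ih x'
    refine ⟨Fin.cons c₀ c, Fin.cases hc₀ hc, y, ?_⟩
    rw [sum_mul_pow_succ]
    simp only [Fin.cons_zero, Fin.cons_succ]
    linear_combination hx' + β * hy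

theorem digits_unique (hβ : IsUniformizer β) (hS : IsRepSystem S) {m : ℕ} {c d : Fin m → 𝒪[K]}
    (hc : ∀ j, c j ∈ S) (hd : ∀ j, d j ∈ S)
    (h : β ^ m ∣ ∑ j, c j * β ^ (j : ℕ) - ∑ j, d j * β ^ (j : ℕ)) : c = d := by
  induction m with
  | zero => exact Subsingleton.elim _ _
  | succ m ih =>
    rw [sum_mul_pow_succ, sum_mul_pow_succ] at h
    obtain ⟨y, hy⟩ := h
    have h0 : c 0 = d 0 := by
      refine hS.injOn (hc 0) (hd 0) ((residue_eq_iff_dvd hβ _ _).2 ⟨β ^ m * y -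
        (∑ i : Fin m, c i.succ * β ^ (i : ℕ) - ∑ i : Fin m, d i.succ * β ^ (i : ℕ)), ?_⟩)
      linear_combination hy
    have h1 := ih (fun i => hc i.succ) (fun i => hd i.succ) ⟨y, by
      apply mul_left_cancel₀ hβ.ne_zero
      linear_combination hy - h0⟩
    exact funext (Fin.cases h0 (congrFun h1))

theorem sum_digits_eq (hβ : IsUniformizer β) (n : ℕ) (c : Fin (2 * n) → 𝒪[K]) :
    ∑ j : Fin (2 * n), (c j : K) * (β : K) ^ ((j : ℤ) - (n : ℤ)) =
      (β : K) ^ (-(n : ℤ)) * ((∑ j, c j * β ^ (j : ℕ) : 𝒪[K]) : K) := by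
  push_cast
  rw [Finset.mul_sum]
  refine Finset.sum_congr rfl fun j _ => ?_
  rw [sub_eq_add_neg, zpow_add₀ hβ.coe_ne_zero, zpow_natCast]
  ring

theorem sub_mem_ball_neg_iff (hβ : IsUniformizer β) (n : ℕ) (x y : 𝒪[K]) :
    (β : K) ^ (-(n : ℤ)) * (x : K) - (β : K) ^ (-(n : ℤ)) * (y : K) ∈ ball β (-(n : ℤ)) ↔
      β ^ (2 * n) ∣ x - y := by
  have hn : (β : K) ^ n ≠ 0 := pow_ne_zero _ hβ.coe_ne_zero
  refine exists_congr fun z => ?_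
  rw [← mul_sub, neg_neg, zpow_neg, zpow_natCast, inv_mul_eq_iff_eq_mul₀ hn, ← mul_assoc, ← pow_add,
    ← two_mul, ← Subtype.coe_inj]
  push_cast
  rfl

theorem grid_subset_ball (hβ : IsUniformizer β) {n : ℕ} {x : K} (hx : x ∈ grid β S n) :
    x ∈ ball β (n : ℤ) := by
  obtain ⟨c, -, rfl⟩ := mem_grid.1 hx
  exact ⟨_, sum_digits_eq hβ n c⟩

theorem exists_mem_grid_sub_mem (hβ : IsUniformizer β) (hS : IsRepSystem S) {n : ℕ} {x : K}
    (hx : x ∈ ball β (n : ℤ)) : ∃ y ∈ grid β S n, x - y ∈ ball β (-(n : ℤ)) := by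
  obtain ⟨o, rfl⟩ := hx
  obtain ⟨c, hc, hd⟩ := exists_digits hβ hS (2 * n) o
  refine ⟨_, mem_grid.2 ⟨c, hc, rfl⟩, ?_⟩
  rw [sum_digits_eq hβ, sub_mem_ball_neg_iff hβ]
  exact hd

theorem eq_of_sub_mem_ball (hβ : IsUniformizer β) (hS : IsRepSystem S) {n : ℕ} {x y : K}
    (hx : x ∈ grid β S n) (hy : y ∈ grid β S n) (h : x - y ∈ ball β (-(n : ℤ))) : x = y := by
  obtain ⟨c, hc, rfl⟩ := mem_grid.1 hx
  obtain ⟨d, hd, rfl⟩ := mem_grid.1 hy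
  rw [sum_digits_eq hβ, sum_digits_eq hβ, sub_mem_ball_neg_iff hβ] at h
  rw [digits_unique hβ hS hc hd h]

theorem card_grid (hβ : IsUniformizer β) (hS : IsRepSystem S) (n : ℕ) :
    (grid β S n).card = resCard K ^ (2 * n) := by
  classical
  rw [grid, Finset.card_image_of_injOn, Fintype.card_piFinset, Finset.prod_const, hS.card_eq,
    Finset.card_univ, Fintype.card_fin]
  intro c hc d hd h
  rw [Finset.mem_coe, Fintype.mem_piFinset] at hc hd
  refine digits_unique hβ hS hc hd ((sub_mem_ball_neg_iff hβ n _ _).1 ?_)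
  rw [← sum_digits_eq hβ, ← sum_digits_eq hβ, sub_eq_zero.2 h]
  exact zero_mem_ball hβ _

/-- The canonical representative in the grid `X_n` of a point of `B_n` modulo `B_{-n}`, with the
junk value `0` at points that are congruent to no grid point. -/
def gridRep (β : 𝒪[K]) (S : Finset 𝒪[K]) (n : ℕ) (x : K) : K :=
  open Classical in
  if h : ∃ y ∈ grid β S n, x - y ∈ ball β (-(n : ℤ)) then h.choose else 0

theorem gridRep_spec (hβ : IsUniformizer β) (hS : IsRepSystem S) {n : ℕ} {x : K}
    (hx : x ∈ ball β (n : ℤ)) :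
    gridRep β S n x ∈ grid β S n ∧ x - gridRep β S n x ∈ ball β (-(n : ℤ)) := by
  have h := exists_mem_grid_sub_mem hβ hS hx
  rw [gridRep, dif_pos h]
  exact h.choose_spec

theorem gridRep_eq_iff (hβ : IsUniformizer β) (hS : IsRepSystem S) {n : ℕ} {x b : K}
    (hx : x ∈ ball β (n : ℤ)) (hb : b ∈ grid β S n) :
    gridRep β S n x = b ↔ x - b ∈ ball β (-(n : ℤ)) := by
  obtain ⟨hmem, hsub⟩ := gridRep_spec hβ hS hx
  refine ⟨fun h => h ▸ hsub, fun h => eq_of_sub_mem_ball hβ hS hmem hb ?_⟩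
  simpa only [sub_sub_sub_cancel_left] using sub_mem_ball hβ h hsub

theorem gridRep_gridRep_add_sub (hβ : IsUniformizer β) (hS : IsRepSystem S) {n : ℕ} {x c : K}
    (hx : x ∈ grid β S n) (hc : c ∈ ball β (n : ℤ)) :
    gridRep β S n (gridRep β S n (x + c) - c) = x := by
  have h := gridRep_spec hβ hS (add_mem_ball hβ (grid_subset_ball hβ hx) hc)
  rw [gridRep_eq_iff hβ hS (sub_mem_ball hβ (grid_subset_ball hβ h.1) hc) hx]
  have := (ballSubgroup hβ (-(n : ℤ))).neg_mem h.2
  rwa [neg_sub, ← sub_sub, sub_right_comm] at this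

theorem sum_grid_add (hβ : IsUniformizer β) (hS : IsRepSystem S) {M : Type*} [AddCommMonoid M]
    {n : ℕ} {f : K → M} (hf : ∀ x, ∀ h ∈ ball β (-(n : ℤ)), f (x + h) = f x) {c : K}
    (hc : c ∈ ball β (n : ℤ)) :
    ∑ x ∈ grid β S n, f (x + c) = ∑ x ∈ grid β S n, f x := by
  have hc' : -c ∈ ball β (n : ℤ) := (ballSubgroup hβ n).neg_mem hc
  have hrep {d x : K} (hd : d ∈ ball β (n : ℤ)) (hx : x ∈ grid β S n) :=
    gridRep_spec hβ hS (add_mem_ball hβ (grid_subset_ball hβ hx) hd)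
  refine Finset.sum_nbij' (fun x => gridRep β S n (x + c)) (fun x => gridRep β S n (x + -c))
    (fun x hx => (hrep hc hx).1) (fun x hx => (hrep hc' hx).1) (fun x hx => ?_) (fun x hx => ?_)
    fun x hx => ?_
  · simpa only [← sub_eq_add_neg] using gridRep_gridRep_add_sub hβ hS hx hc
  · simpa only [sub_neg_eq_add] using gridRep_gridRep_add_sub hβ hS hx hc'
  · rw [← hf (gridRep β S n (x + c)) _ (hrep hc hx).2, add_sub_cancel]

end Grid

section Fourier

variable {K : Type*} [Field K] [ValuativeRel K] [TopologicalSpace K]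
  [IsNonarchimedeanLocalField K] {β : 𝒪[K]} {S : Finset 𝒪[K]} {χ : AddChar K Circle}

theorem char_mul_eq_one (hβ : IsUniformizer β) (hχ : IsRankZeroChar β χ) {r : ℤ} {x y : K}
    (hx : x ∈ ball β r) (hy : y ∈ ball β (-r)) : χ (x * y) = 1 :=
  hχ.2.1 _ (add_neg_cancel r ▸ mul_mem_ball hβ hx hy)

theorem exists_char_mul_ne_one (hβ : IsUniformizer β) (hχ : IsRankZeroChar β χ) {r : ℤ} {y : K}
    (hy : y ∉ ball β (-r)) : ∃ x ∈ ball β r, χ (y * x) ≠ 1 := by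
  have hχ1 : ¬ ∀ x ∈ ball β 1, χ x = 1 := fun h => one_pos.not_ge (hχ.2.2 h)
  push Not at hχ1
  obtain ⟨x, hx, hx1⟩ := hχ1
  have hy0 : y ≠ 0 := by
    rintro rfl
    exact hy (zero_mem_ball hβ _)
  refine ⟨y⁻¹ * x, ?_, by rwa [mul_inv_cancel_left₀ hy0]⟩
  simpa using mul_mem_ball hβ (inv_mem_ball hβ hy) hx

open Classical in
theorem sum_grid_ball_char_mul (hβ : IsUniformizer β) (hS : IsRepSystem S)
    (hχ : IsRankZeroChar β χ) {n : ℕ} {r : ℤ} (hr : -(n : ℤ) ≤ r) (hr' : r ≤ n) {z : K}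
    (hz : z ∈ ball β (n : ℤ)) :
    ∑ y ∈ grid β S n, (if y ∈ ball β r then (χ (z * y) : ℂ) else 0) =
      if z ∈ ball β (-r) then (((grid β S n).filter (· ∈ ball β r)).card : ℂ) else 0 := by
  split_ifs with h
  · rw [← Finset.sum_filter, Finset.cast_card]
    refine Finset.sum_congr rfl fun y hy => ?_
    rw [mul_comm, char_mul_eq_one hβ hχ (Finset.mem_filter.1 hy).2 h, Circle.coe_one]
  · obtain ⟨x, hx, hx1⟩ := exists_char_mul_ne_one hβ hχ h
    have hmem : ∀ y c, c ∈ ball β r → (y + c ∈ ball β r ↔ y ∈ ball β r) := fun y c hc =>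
      (ballSubgroup hβ r).add_mem_cancel_right hc
    have hshift := sum_grid_add hβ hS (n := n)
      (f := fun y => if y ∈ ball β r then (χ (z * y) : ℂ) else 0)
      (fun y c hc => by
        simp only [hmem y c (ball_mono hβ hr hc), mul_add, AddChar.map_add_eq_mul,
          char_mul_eq_one hβ hχ hz hc, mul_one])
      (ball_mono hβ hr' hx)
    simp only [hmem _ x hx, mul_add, AddChar.map_add_eq_mul, Circle.coe_mul, ← ite_zero_mul,
      ← Finset.sum_mul] at hshift
    by_contra h0
    exact hx1 (Circle.ext ((mul_eq_left₀ h0).1 hshift))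

open Classical in
theorem sum_grid_char_mul (hβ : IsUniformizer β) (hS : IsRepSystem S) (hχ : IsRankZeroChar β χ)
    {n : ℕ} {z : K} (hz : z ∈ ball β (n : ℤ)) :
    ∑ y ∈ grid β S n, (χ (z * y) : ℂ) =
      if z ∈ ball β (-(n : ℤ)) then (resCard K : ℂ) ^ (2 * n) else 0 := by
  have h := sum_grid_ball_char_mul hβ hS hχ (n := n) (r := n) (by omega) le_rfl hz
  rw [Finset.filter_true_of_mem fun y hy => grid_subset_ball hβ hy, card_grid hβ hS,
    Nat.cast_pow] at h
  rw [← h]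
  exact Finset.sum_congr rfl fun y hy => (if_pos (grid_subset_ball hβ hy)).symm

theorem sum_invFourier_mul_char (hβ : IsUniformizer β) (hS : IsRepSystem S)
    (hχ : IsRankZeroChar β χ) {n : ℕ} (f : K → ℂ) {y : K} (hy : y ∈ grid β S n) :
    ∑ z ∈ grid β S n, invFourier β S χ n f z * χ (-(z * y)) = (resCard K : ℂ) ^ n * f y := by
  classical
  have horth : ∀ y' ∈ grid β S n, ∑ z ∈ grid β S n, (χ (z * y') : ℂ) * χ (-(z * y)) =
      if y' = y then (resCard K : ℂ) ^ (2 * n) else 0 := fun y' hy' => by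
    have hiff : y' - y ∈ ball β (-(n : ℤ)) ↔ y' = y :=
      ⟨eq_of_sub_mem_ball hβ hS hy' hy, fun h => by
        rw [h, sub_self]
        exact zero_mem_ball hβ _⟩
    rw [← if_congr hiff rfl rfl, ← sum_grid_char_mul hβ hS hχ
      (sub_mem_ball hβ (grid_subset_ball hβ hy') (grid_subset_ball hβ hy))]
    refine Finset.sum_congr rfl fun z _ => ?_
    rw [← Circle.coe_mul, ← AddChar.map_add_eq_mul, sub_mul, sub_eq_add_neg, mul_comm z, mul_comm z]
  calc ∑ z ∈ grid β S n, invFourier β S χ n f z * χ (-(z * y))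
      = ((resCard K : ℂ) ^ n)⁻¹ * ∑ y' ∈ grid β S n,
          f y' * ∑ z ∈ grid β S n, (χ (z * y') : ℂ) * χ (-(z * y)) := by
        simp only [invFourier, mul_assoc, ← Finset.mul_sum, Finset.sum_mul]
        simp only [Finset.mul_sum]
        rw [Finset.sum_comm]
    _ = ((resCard K : ℂ) ^ n)⁻¹ * (f y * (resCard K : ℂ) ^ (2 * n)) := by
        rw [Finset.sum_congr rfl fun y' hy' => by rw [horth y' hy']]
        simp only [mul_ite, mul_zero, Finset.sum_ite_eq', hy, if_true]
    _ = (resCard K : ℂ) ^ n * f y := by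
        have hq := pow_ne_zero n (resCard_ne_zero (K := K))
        field_simp
        ring

end Fourier

section JumpRate

variable {K : Type*} [Field K] [ValuativeRel K] [TopologicalSpace K]
  [IsNonarchimedeanLocalField K] {β : 𝒪[K]} {S : Finset 𝒪[K]} {χ : AddChar K Circle}
  {α : ℝ} {n : ℕ}

theorem exists_forall_mem_ball_sub_iff_le (hβ : IsUniformizer β) {y : K}
    (hy : y ∈ ball β (n : ℤ)) : ∃ m ≤ 2 * n, ∀ k : ℕ, y ∈ ball β ((k : ℤ) - n) ↔ m ≤ k := by
  classical
  have hy' : y ∈ ball β (((2 * n : ℕ) : ℤ) - n) := ball_mono hβ (by omega) hy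
  have hex : ∃ k : ℕ, y ∈ ball β ((k : ℤ) - n) := ⟨_, hy'⟩
  exact ⟨Nat.find hex, Nat.find_min' hex hy', fun k => ⟨fun h => Nat.find_min' hex h,
    fun h => ball_mono hβ (by omega) (Nat.find_spec hex)⟩⟩

theorem canonAbs_rpow_eq_of_forall_mem_ball_sub_iff (hβ : IsUniformizer β) (hS : IsRepSystem S)
    (hα : 0 < α) (h0 : (0 : K) ∈ grid β S n) {y : K} (hy : y ∈ grid β S n) {m : ℕ}
    (hm : ∀ k : ℕ, y ∈ ball β ((k : ℤ) - n) ↔ m ≤ k) :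
    canonAbs y ^ α = if m = 0 then 0 else (canonAbs (β : K) ^ (n - m : ℤ)) ^ α := by
  have hmem := (hm m).2 le_rfl
  split_ifs with h
  · have hy0 : y = 0 := eq_of_sub_mem_ball hβ hS hy h0 (by simpa [h] using hmem)
    rw [hy0, canonAbs_zero, Real.zero_rpow hα.ne']
  · have hnot : y ∉ ball β ((m : ℤ) - n - 1) := by
      convert mt (hm (m - 1)).1 (by omega) using 3
      omega
    rw [canonAbs_eq_of_mem_sphere hβ hmem hnot, neg_sub]

/-- Layer-cake decomposition: on the grid `|·|^α` is a nonnegative combination of indicators of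
complements of balls. -/
theorem exists_canonAbs_rpow_eq_sum (hβ : IsUniformizer β) (hS : IsRepSystem S) (hα : 0 < α)
    (h0 : (0 : K) ∈ grid β S n) :
    open Classical in
    ∃ w : ℕ → ℝ, (∀ k, 0 ≤ w k) ∧ ∀ y ∈ grid β S n, canonAbs y ^ α =
      ∑ k ∈ Finset.range (2 * n), if y ∈ ball β ((k : ℤ) - n) then 0 else w k := by
  have hb := canonAbs_pos hβ.coe_ne_zero
  let v : ℕ → ℝ := fun m => if m = 0 then 0 else (canonAbs (β : K) ^ (n - m : ℤ)) ^ α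
  refine ⟨fun k => v (k + 1) - v k, fun k => ?_, fun y hy => ?_⟩
  · simp only [v, Nat.succ_ne_zero, if_false, sub_nonneg]
    split_ifs
    · positivity
    · exact Real.rpow_le_rpow (by positivity) (zpow_le_zpow_right_of_le_one₀ hb
        (canonAbs_uniformizer_lt_one hβ).le (by push_cast; omega)) hα.le
  · obtain ⟨m, hm2, hm⟩ := exists_forall_mem_ball_sub_iff_le hβ (grid_subset_ball hβ hy)
    calc canonAbs y ^ α = v m := canonAbs_rpow_eq_of_forall_mem_ball_sub_iff hβ hS hα h0 hy hm
      _ = ∑ k ∈ Finset.range m, (v (k + 1) - v k) := by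
        rw [Finset.sum_range_sub, show v 0 = 0 from if_pos rfl, sub_zero]
      _ = _ := by
        simp only [hm]
        refine Finset.sum_subset_zero_on_sdiff (Finset.range_subset_range.2 hm2)
          (fun k hk => if_pos ?_) fun k hk => (if_neg ?_).symm
        · simpa using (Finset.mem_sdiff.1 hk).2
        · simpa using hk

open Classical in
theorem exists_sum_grid_notMem_ball_char_mul_eq_neg (hβ : IsUniformizer β) (hS : IsRepSystem S)
    (hχ : IsRankZeroChar β χ) {r : ℤ} (hr : -(n : ℤ) ≤ r) (hr' : r ≤ n) {z : K}
    (hz : z ∈ ball β (n : ℤ)) (hz' : z ∉ ball β (-(n : ℤ))) :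
    ∃ N : ℕ, ∑ y ∈ grid β S n, (if y ∈ ball β r then 0 else (χ (z * y) : ℂ)) = -N := by
  have hsplit : ∀ y, (if y ∈ ball β r then 0 else (χ (z * y) : ℂ)) =
      χ (z * y) - if y ∈ ball β r then (χ (z * y) : ℂ) else 0 := fun y => by
    split_ifs <;> ring
  simp only [hsplit, Finset.sum_sub_distrib, sum_grid_ball_char_mul hβ hS hχ hr hr' hz,
    sum_grid_char_mul hβ hS hχ hz, if_neg hz', zero_sub, neg_inj]
  split_ifs
  exacts [⟨_, rfl⟩, ⟨0, Nat.cast_zero.symm⟩]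

theorem exists_invFourier_canonAbs_rpow_eq_neg (hβ : IsUniformizer β) (hS : IsRepSystem S)
    (hχ : IsRankZeroChar β χ) (hα : 0 < α) (h0 : (0 : K) ∈ grid β S n) {z : K}
    (hz : z ∈ grid β S n) (hz0 : z ≠ 0) :
    ∃ c : ℝ, 0 ≤ c ∧ invFourier β S χ n (fun y => ((canonAbs y ^ α : ℝ) : ℂ)) z = -(c : ℂ) := by
  classical
  obtain ⟨w, hw, hlayer⟩ := exists_canonAbs_rpow_eq_sum hβ hS hα h0
  have hz' : z ∉ ball β (-(n : ℤ)) := fun h =>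
    hz0 (eq_of_sub_mem_ball hβ hS hz h0 (by rwa [sub_zero]))
  have hN : ∀ k ∈ Finset.range (2 * n), ∃ N : ℕ, ∑ y ∈ grid β S n,
      (if y ∈ ball β ((k : ℤ) - n) then 0 else (χ (z * y) : ℂ)) = -N := fun k hk => by
    rw [Finset.mem_range] at hk
    exact exists_sum_grid_notMem_ball_char_mul_eq_neg hβ hS hχ (by omega) (by omega)
      (grid_subset_ball hβ hz) hz'
  choose! N hN using hN
  have hsum : ∑ y ∈ grid β S n, ((canonAbs y ^ α : ℝ) : ℂ) * χ (z * y) =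
      -∑ k ∈ Finset.range (2 * n), ((w k * N k : ℝ) : ℂ) :=
    calc ∑ y ∈ grid β S n, ((canonAbs y ^ α : ℝ) : ℂ) * χ (z * y)
        = ∑ y ∈ grid β S n, ∑ k ∈ Finset.range (2 * n),
            (w k : ℂ) * if y ∈ ball β ((k : ℤ) - n) then 0 else (χ (z * y) : ℂ) := by
          refine Finset.sum_congr rfl fun y hy => ?_
          rw [hlayer y hy, Complex.ofReal_sum, Finset.sum_mul]
          refine Finset.sum_congr rfl fun k _ => ?_
          split_ifs <;> simp
      _ = ∑ k ∈ Finset.range (2 * n), (w k : ℂ) * -N k := by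
          rw [Finset.sum_comm]
          exact Finset.sum_congr rfl fun k hk => by rw [← Finset.mul_sum, hN k hk]
      _ = _ := by
          rw [← Finset.sum_neg_distrib]
          push_cast
          simp only [mul_neg]
  refine ⟨((resCard K : ℝ) ^ n)⁻¹ * ∑ k ∈ Finset.range (2 * n), w k * N k, mul_nonneg
    (by positivity) (Finset.sum_nonneg fun k _ => mul_nonneg (hw k) (Nat.cast_nonneg _)), ?_⟩
  rw [invFourier, hsum]
  push_cast
  ring

/-- The rate at which the walk on `X_n` jumps by `z ≠ 0`: minus the normalised inverse Fourier
transform of `|·|^α`, which is real and nonnegative away from `0`. Its value at `z = 0` plays no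
role, so truncation by `Real.toNNReal` is harmless. -/
def jumpRate (β : 𝒪[K]) (S : Finset 𝒪[K]) (χ : AddChar K Circle) (α : ℝ) (n : ℕ) (z : K) :
    NNReal :=
  (-((resCard K : ℂ) ^ n)⁻¹ *
    invFourier β S χ n (fun y => ((canonAbs y ^ α : ℝ) : ℂ)) z).re.toNNReal

theorem coe_jumpRate (hβ : IsUniformizer β) (hS : IsRepSystem S)
    (hχ : IsRankZeroChar β χ) (hα : 0 < α) (h0 : (0 : K) ∈ grid β S n) {z : K}
    (hz : z ∈ grid β S n) (hz0 : z ≠ 0) :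
    ((jumpRate β S χ α n z : ℝ) : ℂ) =
      -((resCard K : ℂ) ^ n)⁻¹ * invFourier β S χ n (fun y => ((canonAbs y ^ α : ℝ) : ℂ)) z := by
  obtain ⟨c, hc0, hc⟩ := exists_invFourier_canonAbs_rpow_eq_neg hβ hS hχ hα h0 hz hz0
  have hreal : -((resCard K : ℂ) ^ n)⁻¹ * -(c : ℂ) =
      ((((resCard K : ℝ) ^ n)⁻¹ * c : ℝ) : ℂ) := by
    push_cast
    ring
  rw [jumpRate, hc, hreal, Complex.ofReal_re, Real.coe_toNNReal _ (by positivity)]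

/-- The Lévy–Khinchin formula for the walk. -/
theorem sum_jumpRate_mul_char_sub_one (hβ : IsUniformizer β) (hS : IsRepSystem S)
    (hχ : IsRankZeroChar β χ) (hα : 0 < α) (h0 : (0 : K) ∈ grid β S n) {y : K}
    (hy : y ∈ grid β S n) :
    ∑ z ∈ grid β S n, ((jumpRate β S χ α n z : ℝ) : ℂ) * (χ (-(z * y)) - 1) =
      -((canonAbs y ^ α : ℝ) : ℂ) := by
  let f : K → ℂ := fun y => ((canonAbs y ^ α : ℝ) : ℂ)
  have hq := pow_ne_zero n (resCard_ne_zero (K := K))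
  have hf0 : f 0 = 0 := by simp only [f, canonAbs_zero, Real.zero_rpow hα.ne', Complex.ofReal_zero]
  have hsum0 : ∑ z ∈ grid β S n, invFourier β S χ n f z = 0 := by
    simpa [hf0] using sum_invFourier_mul_char hβ hS hχ f h0
  calc ∑ z ∈ grid β S n, ((jumpRate β S χ α n z : ℝ) : ℂ) * (χ (-(z * y)) - 1)
      = ∑ z ∈ grid β S n, -((resCard K : ℂ) ^ n)⁻¹ * invFourier β S χ n f z *
          (χ (-(z * y)) - 1) := by
        refine Finset.sum_congr rfl fun z hz => ?_
        rcases eq_or_ne z 0 with rfl | hz0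
        · simp only [zero_mul, neg_zero, AddChar.map_zero_eq_one, Circle.coe_one, sub_self,
            mul_zero]
        · rw [coe_jumpRate hβ hS hχ hα h0 hz hz0]
    _ = -((resCard K : ℂ) ^ n)⁻¹ * ∑ z ∈ grid β S n, invFourier β S χ n f z * χ (-(z * y)) := by
        simp only [mul_assoc, ← Finset.mul_sum, mul_sub, mul_one, Finset.sum_sub_distrib, hsum0]
        rw [mul_zero, sub_zero]
    _ = -f y := by
        rw [sum_invFourier_mul_char hβ hS hχ f hy, ← mul_assoc, neg_mul, inv_mul_cancel₀ hq,
          neg_one_mul]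

end JumpRate

section Evaluation

variable {K : Type*} [Field K] [ValuativeRel K] [TopologicalSpace K]
  [IsNonarchimedeanLocalField K] {β : 𝒪[K]} {t : ℝ} {r : ℤ} {U : Set K}

omit [TopologicalSpace K] [IsNonarchimedeanLocalField K] in
theorem mem_iff_of_sub_mem_ball (hU : ∀ x, ∀ h ∈ ball β r, x + h ∈ U ↔ x ∈ U) {x y : K}
    (h : x - y ∈ ball β r) : x ∈ U ↔ y ∈ U := by
  rw [← hU y _ h, add_sub_cancel]

theorem eventually_mem_iff_of_tendsto (hβ : IsUniformizer β)
    (hU : ∀ x, ∀ h ∈ ball β r, x + h ∈ U ↔ x ∈ U) {ι : Type*} {l : Filter ι} {f : ι → K} {x : K}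
    (hf : Tendsto f l (𝓝 x)) : ∀ᶠ i in l, f i ∈ U ↔ x ∈ U := by
  have h := hf.sub_const x
  rw [sub_self] at h
  filter_upwards [h (ball_mem_nhds hβ r)] with i hi
  exact mem_iff_of_sub_mem_ball hU hi

theorem mem_ball_of_canonAbs_lt (hβ : IsUniformizer β) {x : K}
    (hx : canonAbs x < canonAbs (β : K) ^ (-r - 1)) : x ∈ ball β r := by
  by_contra h
  exact hx.not_ge (le_canonAbs_of_notMem_ball hβ h)

/-- `ω` stays in `U` on a neighbourhood of `[c, d]`; this is stable under small time changes. -/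
def staysNear (U : Set K) (c d : Set.Icc (0 : ℝ) t) : Set (SkorokhodSpace K t) :=
  {ω | ∃ c' < c, ∃ d' > d, ∀ s ∈ Set.Icc c' d', ω.path s ∈ U}

theorem isOpen_staysNear (hβ : IsUniformizer β) (hU : ∀ x, ∀ h ∈ ball β r, x + h ∈ U ↔ x ∈ U)
    (c d : Set.Icc (0 : ℝ) t) : IsOpen (staysNear U c d) := by
  rintro ω ⟨c', hc', d', hd', hω⟩
  obtain ⟨c₁, hc₁', hc₁⟩ := exists_between hc'
  obtain ⟨d₁, hd₁, hd₁'⟩ := exists_between hd'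
  refine ⟨min (canonAbs (β : K) ^ (-r - 1)) (min (c₁ - c') (d' - d₁)), lt_min
    (zpow_pos (canonAbs_pos hβ.coe_ne_zero) _) (lt_min (sub_pos.2 hc₁') (sub_pos.2 hd₁')), ?_⟩
  rintro ω' ⟨τ, hτ, hnear⟩
  refine ⟨c₁, hc₁, d₁, hd₁, fun s hs => ?_⟩
  obtain ⟨s, rfl⟩ := τ.surjective s
  have hτs := (hτ s).trans_le (min_le_right _ _)
  have hmem : s ∈ Set.Icc c' d' := by
    have hlow := abs_lt.1 (hτs.trans_le (min_le_left _ _))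
    have hupp := abs_lt.1 (hτs.trans_le (min_le_right _ _))
    have hs₁ : (c₁ : ℝ) ≤ τ s := hs.1
    have hs₂ : (τ s : ℝ) ≤ d₁ := hs.2
    constructor <;> rw [← Subtype.coe_le_coe] <;> linarith
  exact (mem_iff_of_sub_mem_ball hU (mem_ball_of_canonAbs_lt hβ
    ((hnear s).trans_le (min_le_left _ _)))).1 (hω s hmem)

theorem setOf_path_mem_eq_iUnion_iInter (hβ : IsUniformizer β)
    (hU : ∀ x, ∀ h ∈ ball β r, x + h ∈ U ↔ x ∈ U) {s e : Set.Icc (0 : ℝ) t} (hse : s < e)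
    {u : ℕ → Set.Icc (0 : ℝ) t} (hsu : ∀ m, s < u m) (hu : Tendsto u atTop (𝓝 s)) :
    {ω : SkorokhodSpace K t | ω.path s ∈ U} = ⋃ m, ⋂ l, staysNear U (u l) (u m) := by
  ext ω
  have hright := eventually_mem_iff_of_tendsto hβ hU (ω.rightCont s)
  obtain ⟨e', hse', he'⟩ := (mem_nhdsGT_iff_exists_Ioo_subset' hse).1 hright
  simp only [Set.mem_ofPred_eq, Set.mem_iUnion, Set.mem_iInter]
  constructor
  · intro hω
    obtain ⟨m, hm⟩ := (hu.eventually (gt_mem_nhds hse')).exists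
    obtain ⟨d, hd, hde'⟩ := exists_between hm
    refine ⟨m, fun l => ?_⟩
    obtain ⟨c, hsc, hc⟩ := exists_between (hsu l)
    exact ⟨c, hc, d, hd, fun v hv => (he' ⟨hsc.trans_le hv.1, hv.2.trans_lt hde'⟩).2 hω⟩
  · rintro ⟨m, hm⟩
    obtain ⟨v, hsv, hv⟩ := exists_between (lt_min hse' (hsu m))
    obtain ⟨l, hl⟩ := (hu.eventually (gt_mem_nhds hsv)).exists
    obtain ⟨c, hc, d, hd, hω⟩ := hm l
    exact (he' ⟨hsv, hv.trans_le (min_le_left _ _)⟩).1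
      (hω v ⟨(hc.trans hl).le, (hv.trans_le (min_le_right _ _)).le.trans hd.le⟩)

theorem isOpen_setOf_path_mem_of_isTop (hβ : IsUniformizer β)
    (hU : ∀ x, ∀ h ∈ ball β r, x + h ∈ U ↔ x ∈ U) {s : Set.Icc (0 : ℝ) t} (hs : IsTop s) :
    IsOpen {ω : SkorokhodSpace K t | ω.path s ∈ U} := by
  refine fun ω hω => ⟨_, zpow_pos (canonAbs_pos hβ.coe_ne_zero) (-r - 1), ?_⟩
  rintro ω' ⟨τ, -, hnear⟩
  have hτs : τ s = s := (hs _).antisymm (by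
    rw [← τ.symm_apply_le]
    exact hs _)
  have h := mem_ball_of_canonAbs_lt hβ (hnear s)
  rw [hτs] at h
  exact (mem_iff_of_sub_mem_ball hU h).1 hω

theorem measurableSet_setOf_path_mem (hβ : IsUniformizer β)
    (hU : ∀ x, ∀ h ∈ ball β r, x + h ∈ U ↔ x ∈ U) (s : Set.Icc (0 : ℝ) t) :
    MeasurableSet {ω : SkorokhodSpace K t | ω.path s ∈ U} := by
  by_cases hs : IsTop s
  · exact (isOpen_setOf_path_mem_of_isTop hβ hU hs).measurableSet
  · obtain ⟨e, he⟩ := not_forall.1 hs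
    obtain ⟨u, -, hsu, hu⟩ := exists_seq_strictAnti_tendsto' (not_le.1 he)
    rw [setOf_path_mem_eq_iUnion_iInter hβ hU (not_le.1 he) (fun m => (hsu m).1) hu]
    exact .iUnion fun m => .iInter fun l => (isOpen_staysNear hβ hU _ _).measurableSet

theorem measurableSet_setOf_path_eq (hβ : IsUniformizer β) (s : Set.Icc (0 : ℝ) t) (b : K) :
    MeasurableSet {ω : SkorokhodSpace K t | ω.path s = b} := by
  have h : {ω : SkorokhodSpace K t | ω.path s = b} =
      ⋂ k : ℕ, {ω | ω.path s ∈ {x | x - b ∈ ball β (-(k : ℤ))}} := by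
    ext ω
    rw [Set.mem_ofPred_eq, ← Set.mem_singleton_iff, ← iInter_setOf_sub_mem_ball hβ b]
    simp only [Set.mem_iInter, Set.mem_ofPred_eq]
  rw [h]
  refine .iInter fun k => measurableSet_setOf_path_mem hβ (r := -k) (fun x h hh => ?_) s
  rw [Set.mem_ofPred_eq, add_sub_right_comm]
  exact (ballSubgroup hβ (-k)).add_mem_cancel_right hh

theorem measurableSet_setOf_path_mem_finset (hβ : IsUniformizer β) (s : Set.Icc (0 : ℝ) t)
    (F : Finset K) : MeasurableSet {ω : SkorokhodSpace K t | ω.path s ∈ F} := by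
  have h : {ω : SkorokhodSpace K t | ω.path s ∈ F} = ⋃ b ∈ F, {ω | ω.path s = b} := by
    ext ω
    simp
  rw [h]
  exact F.measurableSet_biUnion fun b _ => measurableSet_setOf_path_eq hβ s b

theorem exists_mem_ball (hβ : IsUniformizer β) (x : K) : ∃ r : ℤ, x ∈ ball β r := by
  have hβ0 : 0 < canonAbs (β : K) := canonAbs_pos hβ.coe_ne_zero
  obtain ⟨k, hk⟩ := exists_pow_lt_of_lt_one (inv_pos.2 (lt_of_le_of_lt (canonAbs_nonneg x)
    (lt_add_one _))) (canonAbs_uniformizer_lt_one hβ)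
  refine ⟨k - 1, mem_ball_of_canonAbs_lt hβ ?_⟩
  calc canonAbs x < canonAbs x + 1 := lt_add_one _
    _ < (canonAbs (β : K) ^ k)⁻¹ := (lt_inv_comm₀ (pow_pos hβ0 k)
        (add_pos_of_nonneg_of_pos (canonAbs_nonneg x) one_pos)).1 hk
    _ = canonAbs (β : K) ^ (-((k : ℤ) - 1) - 1) := by
        rw [← zpow_natCast, ← zpow_neg]
        congr 1
        ring

theorem measurable_char_path_mul (hβ : IsUniformizer β) {χ : AddChar K Circle}
    (hχ : IsRankZeroChar β χ) (s : Set.Icc (0 : ℝ) t) (y : K) :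
    Measurable fun ω : SkorokhodSpace K t => (χ (ω.path s * y) : ℂ) := by
  obtain ⟨r, hr⟩ := exists_mem_ball hβ y
  refine fun A _ => measurableSet_setOf_path_mem hβ (r := -r) (U := {x | (χ (x * y) : ℂ) ∈ A})
    (fun x h hh => ?_) s
  rw [Set.mem_ofPred_eq, add_mul, AddChar.map_add_eq_mul,
    char_mul_eq_one hβ hχ hh ((neg_neg r).symm ▸ hr), mul_one, Set.mem_ofPred_eq]

end Evaluation

section TimeChange

open scoped NNReal

theorem eventually_exists_lipschitzWith_interpolation {ι X : Type*} [Finite ι] [MetricSpace X]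
    {p : ι → X} (hp : Function.Injective p) {C : ℝ≥0} (hC : 0 < C) :
    ∀ᶠ δ : ι → ℝ in 𝓝 0, ∃ h : X → ℝ, LipschitzWith C h ∧ ∀ i, h (p i) = δ i := by
  have hclose : ∀ᶠ δ : ι → ℝ in 𝓝 0, ∀ i j, dist (δ i) (δ j) ≤ C * dist (p i) (p j) := by
    refine eventually_all.2 fun i => eventually_all.2 fun j => ?_
    rcases eq_or_ne i j with rfl | hij
    · simp only [dist_self, mul_zero, le_refl, eventually_true]
    · have hcont : Continuous fun δ : ι → ℝ => dist (δ i) (δ j) := by fun_prop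
      refine (hcont.continuousAt.eventually_lt continuousAt_const ?_).mono fun _ => le_of_lt
      simpa using mul_pos (NNReal.coe_pos.2 hC) (dist_pos.2 (hp.ne hij))
  filter_upwards [hclose] with δ hδ
  have hlip : LipschitzOnWith C (Function.extend p δ 0) (Set.range p) := by
    refine .of_dist_le_mul ?_
    rintro _ ⟨i, rfl⟩ _ ⟨j, rfl⟩
    simpa only [hp.extend_apply] using hδ i j
  obtain ⟨h, hh, heq⟩ := hlip.extend_real
  exact ⟨h, hh, fun i => by rw [← heq (Set.mem_range_self i), hp.extend_apply]⟩

theorem exists_orderIso_Icc_of_lipschitzWith {h : ℝ → ℝ} {C : ℝ≥0} (hh : LipschitzWith C h)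
    (hC : C < 1) {a b : ℝ} (ha : h a = 0) (hb : h b = 0) :
    ∃ τ : Set.Icc a b ≃o Set.Icc a b, ∀ s, (τ s : ℝ) = s + h s := by
  have hmono : StrictMono fun s => s + h s := fun r s hrs => by
    have hC' : (C : ℝ) < 1 := hC
    have hdist := hh.dist_le_mul r s
    rw [Real.dist_eq, Real.dist_eq, abs_sub_comm r, abs_of_pos (sub_pos.2 hrs)] at hdist
    have hle := le_abs_self (h r - h s)
    have hlt := mul_lt_mul_of_pos_right hC' (sub_pos.2 hrs)
    change r + h r < s + h s
    linarith
  have hmaps : Set.MapsTo (fun s => s + h s) (Set.Icc a b) (Set.Icc a b) := by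
    simpa only [ha, hb, add_zero] using hmono.monotone.mapsTo_Icc (a := a) (b := b)
  have hsurj : Set.SurjOn (fun s => s + h s) (Set.Icc a b) (Set.Icc a b) := by
    rcases le_or_gt a b with hab | hab
    · simpa only [Set.SurjOn, Pi.add_apply, id, ha, hb, add_zero] using
        intermediate_value_Icc hab (continuous_id.add hh.continuous).continuousOn
    · rw [Set.Icc_eq_empty hab.not_ge]
      exact Set.surjOn_empty _ _
  have hrestrict : StrictMono (hmaps.restrict _ _ _) := fun _ _ hrs => hmono hrs
  exact ⟨hrestrict.orderIsoOfSurjective _ (hmaps.restrict_surjective_iff.2 hsurj), fun _ => rfl⟩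

/-- The displacement of the time change interpolates `u' - u` at the points `u` and `0` at the
end points, with a small Lipschitz constant. -/
theorem eventually_exists_timeChange {ι : Type*} [Finite ι] {t : ℝ} {u : ι → ℝ} (ht : 0 < t)
    (hu : ∀ i, u i ∈ Set.Ioo 0 t) (hinj : Function.Injective u) {ε : ℝ} (hε : 0 < ε) :
    ∀ᶠ u' in 𝓝 u, ∃ τ : Set.Icc (0 : ℝ) t ≃o Set.Icc (0 : ℝ) t,
      (∀ s, |(τ s : ℝ) - s| < ε) ∧
        ∀ i (s : Set.Icc (0 : ℝ) t), u i ≤ s ↔ u' i ≤ (τ s : ℝ) := by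
  obtain ⟨C, hC0, hC⟩ := exists_between (lt_min one_pos (div_pos hε ht))
  lift C to ℝ≥0 using hC0.le
  have hp : Function.Injective (Sum.elim u ![0, t]) := by
    refine hinj.sumElim ?_ fun i j => ?_
    · intro i j
      fin_cases i <;> fin_cases j <;> simp [ht.ne, ht.ne']
    · fin_cases j
      · exact (hu i).1.ne'
      · exact (hu i).2.ne
  have hδ : Tendsto (fun u' : ι → ℝ => Sum.elim (u' - u) (0 : Fin 2 → ℝ)) (𝓝 u) (𝓝 0) := by
    refine tendsto_pi_nhds.2 (Sum.forall.2 ⟨fun i => ?_, fun _ => tendsto_const_nhds⟩)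
    exact ((continuous_apply i).sub continuous_const).tendsto' _ _ (sub_self (u i))
  filter_upwards [hδ (eventually_exists_lipschitzWith_interpolation hp (NNReal.coe_pos.1 hC0))]
    with u' ⟨h, hh, hval⟩
  have hh0 : h 0 = 0 := hval (Sum.inr 0)
  have hht : h t = 0 := hval (Sum.inr 1)
  obtain ⟨τ, hτ⟩ := exists_orderIso_Icc_of_lipschitzWith hh
    (NNReal.coe_lt_coe.1 (hC.trans_le (min_le_left _ _))) hh0 hht
  refine ⟨τ, fun s => ?_, fun i s => ?_⟩
  · have hdist := hh.dist_le_mul s 0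
    rw [Real.dist_eq, Real.dist_eq, hh0, sub_zero, sub_zero, abs_of_nonneg s.2.1] at hdist
    rw [hτ, add_sub_cancel_left]
    calc |h s| ≤ C * s := hdist
      _ ≤ C * t := mul_le_mul_of_nonneg_left s.2.2 hC0.le
      _ < ε := (lt_div_iff₀ ht).1 (hC.trans_le (min_le_right _ _))
  · have hτu : (τ ⟨u i, (hu i).1.le, (hu i).2.le⟩ : ℝ) = u' i := by
      rw [hτ]
      exact (congrArg (u i + ·) (hval (Sum.inl i))).trans (add_sub_cancel _ _)
    rw [← hτu, Subtype.coe_le_coe, τ.le_iff_le]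
    rfl

end TimeChange

section StepPath

variable {ι E : Type*} {t : ℝ}

theorem eventually_nhdsGT_le_iff (x : ℝ) (s : Set.Icc (0 : ℝ) t) :
    ∀ᶠ r : Set.Icc (0 : ℝ) t in 𝓝[>] s, x ≤ r ↔ x ≤ s := by
  rcases le_or_gt x s with hx | hx
  · filter_upwards [self_mem_nhdsWithin] with r (hr : (s : ℝ) < r)
    exact iff_of_true (hx.trans hr.le) hx
  · filter_upwards [nhdsWithin_le_nhds
      (continuous_subtype_val.continuousAt.eventually_lt continuousAt_const hx)] with r hr
    exact iff_of_false hr.not_ge hx.not_ge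

theorem eventually_nhdsLT_le_iff (x : ℝ) (s : Set.Icc (0 : ℝ) t) :
    ∀ᶠ r : Set.Icc (0 : ℝ) t in 𝓝[<] s, x ≤ r ↔ x < s := by
  rcases lt_or_ge x s with hx | hx
  · filter_upwards [nhdsWithin_le_nhds
      (continuousAt_const.eventually_lt continuous_subtype_val.continuousAt hx)] with r hr
    exact iff_of_true hr.le hx
  · filter_upwards [self_mem_nhdsWithin] with r (hr : (r : ℝ) < s)
    exact iff_of_false (hr.trans_le hx).not_ge hx.not_gt

variable [Fintype ι] [TopologicalSpace E]

open Classical in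
/-- The step path on `[0,t]` whose value at time `s` is `g I`, where `I` is the set of those `i`
with `u i ≤ s`. A jump time `t` is disregarded, since Skorokhod functions are left-continuous
at `t`. -/
def stepPath (g : Finset ι → E) (t : ℝ) (u : ι → ℝ) : SkorokhodSpace E t where
  path s := g {i | u i ≤ s ∧ u i < t}
  rightCont s := tendsto_const_nhds.congr' <| by
    filter_upwards [eventually_all.2 fun i => eventually_nhdsGT_le_iff (u i) s] with r hr
    simp only [hr]
  leftLim s := ⟨g {i | u i < s ∧ u i < t}, tendsto_const_nhds.congr' <| by
    filter_upwards [eventually_all.2 fun i => eventually_nhdsLT_le_iff (u i) s] with r hr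
    simp only [hr]⟩
  leftContEnd s hs := tendsto_const_nhds.congr' <| by
    filter_upwards [eventually_all.2 fun i => eventually_nhdsLT_le_iff (u i) s] with r hr
    simp only [hr, hs, and_self, and_iff_right_of_imp le_of_lt]

end StepPath

section Measurability

variable {K : Type*} [Field K] [ValuativeRel K] [TopologicalSpace K] [IsNonarchimedeanLocalField K]
  {ι : Type*} [Fintype ι] {t : ℝ}

theorem continuousAt_stepPath (g : Finset ι → K) {u : ι → ℝ} (ht : 0 < t)
    (hu : ∀ i, u i ∈ Set.Ioo 0 t) (hinj : Function.Injective u) :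
    ContinuousAt (stepPath g t) u := by
  refine tendsto_def.2 fun A hA => ?_
  obtain ⟨U, hUA, hU, huU⟩ := mem_nhds_iff.1 hA
  obtain ⟨ε, hε, hnear⟩ := hU _ huU
  have hIoo : ∀ᶠ u' : ι → ℝ in 𝓝 u, ∀ i, u' i < t := eventually_all.2 fun i =>
    (continuous_apply i).continuousAt.eventually_lt continuousAt_const (hu i).2
  filter_upwards [hIoo, eventually_exists_timeChange ht hu hinj hε] with u' hu' ⟨τ, hτ, hle⟩
  refine hUA (hnear _ ⟨τ, hτ, fun s => ?_⟩)
  simpa only [stepPath, (hu _).2, hu', hle, sub_self, canonAbs_zero] using hε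

theorem volume_setOf_apply_eq_apply {i j : ι} (hij : i ≠ j) :
    volume {u : ι → ℝ | u i = u j} = 0 := by
  classical
  let L : (ι → ℝ) →ₗ[ℝ] ℝ := .proj (φ := fun _ => ℝ) i - .proj (φ := fun _ => ℝ) j
  have hker : {u : ι → ℝ | u i = u j} = LinearMap.ker L := by
    ext u
    exact sub_eq_zero.symm
  rw [hker]
  refine Measure.addHaar_submodule _ _ fun htop => ?_
  have hL : L (Pi.single i 1) = 0 := LinearMap.mem_ker.1 (htop ▸ Submodule.mem_top)
  simp [L, hij.symm] at hL

theorem ae_injective : ∀ᵐ u : ι → ℝ, Function.Injective u := by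
  have hne : ∀ᵐ u : ι → ℝ, ∀ i j, i ≠ j → u i ≠ u j :=
    ae_all_iff.2 fun i => ae_all_iff.2 fun j => ae_all_iff.2 fun hij =>
      ae_iff.2 (by simpa only [not_not] using volume_setOf_apply_eq_apply hij)
  exact hne.mono fun u hu => Function.injective_iff_pairwise_ne.2 hu

theorem aemeasurable_stepPath (g : Finset ι → K) (ht : 0 < t) :
    AEMeasurable (stepPath g t) (Measure.pi fun _ => volume.restrict (Set.Ioo 0 t)) := by
  rw [← Measure.restrict_pi_pi]
  have hmem : ∀ᵐ u : ι → ℝ ∂volume.restrict (Set.univ.pi fun _ => Set.Ioo 0 t),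
      u ∈ Set.univ.pi fun _ => Set.Ioo 0 t :=
    ae_restrict_mem (.univ_pi fun _ => measurableSet_Ioo)
  obtain ⟨G, hG, hGmeas, hu⟩ := (hmem.and (ae_restrict_of_ae ae_injective)).exists_measurable_mem
  rw [← volume_pi, ← Measure.restrict_eq_self_of_ae_mem hG]
  refine ContinuousOn.aemeasurable (fun u huG => ?_) hGmeas
  exact (continuousAt_stepPath g ht (fun i => (hu u huG).1 i trivial)
    (hu u huG).2).continuousWithinAt

end Measurability

section DisjointProducts

variable {ι X : Type*} [Fintype ι] {s : ι → Set X}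

theorem prod_ite_mem_eq_one_add_sum_indicator [∀ i, DecidablePred (· ∈ s i)]
    (hs : Pairwise (Function.onFun Disjoint s))
    (w : ι → ℂ) (x : X) :
    ∏ i, (if x ∈ s i then w i else 1) = 1 + ∑ i, (s i).indicator (fun _ => w i - 1) x := by
  by_cases hx : ∃ i, x ∈ s i
  · obtain ⟨i, hi⟩ := hx
    have hne : ∀ j, j ≠ i → x ∉ s j := fun j hji hj => (hs hji).notMem_of_mem_left hj hi
    rw [Fintype.prod_eq_single i fun j hj => if_neg (hne j hj),
      Fintype.sum_eq_single i fun j hj => Set.indicator_of_notMem (hne j hj) _, if_pos hi,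
      Set.indicator_of_mem hi, add_sub_cancel]
  · rw [not_exists] at hx
    rw [Finset.prod_eq_one fun i _ => if_neg (hx i),
      Finset.sum_eq_zero fun i _ => Set.indicator_of_notMem (hx i) _, add_zero]

theorem integral_prod_ite_mem [∀ i, DecidablePred (· ∈ s i)] [MeasurableSpace X] {μ : Measure X}
    [IsFiniteMeasure μ] (hs : Pairwise (Function.onFun Disjoint s))
    (hsm : ∀ i, MeasurableSet (s i)) (w : ι → ℂ) :
    ∫ x, ∏ i, (if x ∈ s i then w i else 1) ∂μ =
      μ.real Set.univ + ∑ i, (μ.real (s i) : ℂ) * (w i - 1) := by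
  have hint : ∀ i, Integrable ((s i).indicator fun _ => w i - 1) μ := fun i =>
    (integrable_const _).indicator (hsm i)
  simp_rw [prod_ite_mem_eq_one_add_sum_indicator hs]
  rw [integral_add (integrable_const _) (integrable_finsetSum _ fun i _ => hint i),
    integral_finsetSum _ fun i _ => hint i, integral_const, Complex.real_smul, mul_one]
  simp only [integral_indicator_const _ (hsm _), Complex.real_smul]

theorem pairwise_disjoint_Ioc_castSucc_succ {N : ℕ} {σ : Fin (N + 1) → ℝ} (hσ : Monotone σ) :
    Pairwise (Function.onFun Disjoint fun i : Fin N => Set.Ioc (σ i.castSucc) (σ i.succ)) := by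
  refine pairwise_disjoint_on _ |>.2 fun i j hij => ?_
  exact Set.Ioc_disjoint_Ioc_of_le (hσ (Fin.succ_le_castSucc_iff.2 hij))

theorem integral_Ioo_prod_ite_mem_Ioc {t : ℝ} {N : ℕ} {σ : Fin (N + 1) → Set.Icc (0 : ℝ) t}
    (hσ : Monotone σ) (w : Fin N → ℂ) :
    ∫ u in Set.Ioo 0 t,
        ∏ i, (if u ∈ Set.Ioc (σ i.castSucc : ℝ) (σ i.succ) then w i else 1) =
      t + ∑ i, (((σ i.succ : ℝ) - σ i.castSucc : ℝ) : ℂ) * (w i - 1) := by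
  rw [integral_prod_ite_mem (pairwise_disjoint_Ioc_castSucc_succ (σ := fun j => (σ j : ℝ)) hσ)
    fun i => measurableSet_Ioc]
  have ht : 0 ≤ t := (σ 0).2.1.trans (σ 0).2.2
  congr 1
  · rw [measureReal_restrict_apply_univ, Real.volume_real_Ioo_of_le ht, sub_zero]
  · refine Finset.sum_congr rfl fun i _ => ?_
    rw [restrict_Ioo_eq_restrict_Ioc, measureReal_restrict_apply measurableSet_Ioc,
      Set.inter_eq_left.2 (Set.Ioc_subset_Ioc (σ _).2.1 (σ _).2.2),
      Real.volume_real_Ioc_of_le (hσ (Fin.castSucc_lt_succ).le)]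

end DisjointProducts

section JumpPath

variable {K : Type*} [Field K] [ValuativeRel K] [TopologicalSpace K] [IsNonarchimedeanLocalField K]
  {β : 𝒪[K]} {S : Finset 𝒪[K]} {χ : AddChar K Circle} {t : ℝ} {n k N : ℕ}

theorem addChar_sum {A M ι : Type*} [AddCommMonoid A] [CommMonoid M] (ψ : AddChar A M)
    (s : Finset ι) (f : ι → A) : ψ (∑ i ∈ s, f i) = ∏ i ∈ s, ψ (f i) := by
  have h := map_prod ψ.toMonoidHom (fun i => Multiplicative.ofAdd (f i)) s
  rwa [← ofAdd_sum] at h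

/-- A character of the increments of a path between the successive times `σ`. The law of these
increments is determined by the integrals of such characters. -/
def incrementChar (χ : AddChar K Circle) (σ : Fin (N + 1) → Set.Icc (0 : ℝ) t) (y : Fin N → K)
    (ω : SkorokhodSpace K t) : ℂ :=
  ∏ i, (χ (-((ω.path (σ i.succ) - ω.path (σ i.castSucc)) * y i)) : ℂ)

theorem measurable_incrementChar (hβ : IsUniformizer β) (hχ : IsRankZeroChar β χ)
    (σ : Fin (N + 1) → Set.Icc (0 : ℝ) t) (y : Fin N → K) :
    Measurable (incrementChar χ σ y) := by
  refine Finset.measurable_fun_prod _ fun i _ => ?_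
  have hmul : ∀ x x' : K, (χ (-((x - x') * y i)) : ℂ) = χ (x' * y i) * χ (x * -y i) :=
    fun x x' => by
      rw [← Circle.coe_mul, ← AddChar.map_add_eq_mul]
      ring_nf
  simp only [hmul]
  exact (measurable_char_path_mul hβ hχ _ _).mul (measurable_char_path_mul hβ hχ _ _)

theorem integrable_incrementChar (hβ : IsUniformizer β) (hχ : IsRankZeroChar β χ)
    (σ : Fin (N + 1) → Set.Icc (0 : ℝ) t) (y : Fin N → K) (P : Measure (SkorokhodSpace K t))
    [IsFiniteMeasure P] : Integrable (incrementChar χ σ y) P :=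
  .of_bound (measurable_incrementChar hβ hχ σ y).aestronglyMeasurable 1
    (ae_of_all _ fun ω => by
      simp only [incrementChar, norm_prod, Circle.norm_coe, Finset.prod_const_one, le_refl])

/-- The path that starts at `a` and jumps at time `u l` by `z l`, in the group structure that the
grid carries over from `B_n / B_{-n}`. -/
def jumpPath (β : 𝒪[K]) (S : Finset 𝒪[K]) (n : ℕ) (a : K) (t : ℝ) (z : Fin k → K)
    (u : Fin k → ℝ) : SkorokhodSpace K t :=
  stepPath (fun I => gridRep β S n (a + ∑ l ∈ I, z l)) t u

theorem jumpPath_path_mem_grid (hβ : IsUniformizer β) (hS : IsRepSystem S) {a : K}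
    (ha : a ∈ ball β (n : ℤ)) {z : Fin k → K} (hz : ∀ l, z l ∈ ball β (n : ℤ)) (u : Fin k → ℝ)
    (s : Set.Icc (0 : ℝ) t) : (jumpPath β S n a t z u).path s ∈ grid β S n :=
  (gridRep_spec hβ hS (add_mem_ball hβ ha ((ballSubgroup hβ n).sum_mem fun l _ => hz l))).1

theorem jumpPath_path_zero (hβ : IsUniformizer β) (hS : IsRepSystem S) {a : K}
    (ha : a ∈ grid β S n) (z : Fin k → K) {u : Fin k → ℝ} (hu : ∀ l, 0 < u l)
    {s : Set.Icc (0 : ℝ) t} (hs : (s : ℝ) = 0) : (jumpPath β S n a t z u).path s = a := by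
  have hle : ∀ l, ¬ (u l ≤ s ∧ u l < t) := fun l h => (hu l).not_ge (h.1.trans_eq hs)
  simp only [jumpPath, stepPath, hle, Finset.filter_false, Finset.sum_empty, add_zero]
  rw [gridRep_eq_iff hβ hS (grid_subset_ball hβ ha) ha, sub_self]
  exact zero_mem_ball hβ _

theorem jumpPath_increment_sub_sum_mem_ball (hβ : IsUniformizer β) (hS : IsRepSystem S) {a : K}
    (ha : a ∈ ball β (n : ℤ)) {z : Fin k → K} (hz : ∀ l, z l ∈ ball β (n : ℤ)) {u : Fin k → ℝ}
    (hu : ∀ l, u l < t) {s s' : Set.Icc (0 : ℝ) t} (hs : s ≤ s') :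
    (jumpPath β S n a t z u).path s' - (jumpPath β S n a t z u).path s -
      ∑ l, (if u l ∈ Set.Ioc (s : ℝ) s' then z l else 0) ∈ ball β (-(n : ℤ)) := by
  let Z : Set.Icc (0 : ℝ) t → K := fun r => ∑ l with u l ≤ r, z l
  have hpath : ∀ r, (jumpPath β S n a t z u).path r = gridRep β S n (a + Z r) := fun r => by
    simp only [jumpPath, stepPath, hu, and_true, Z]
  have hrep : ∀ r, a + Z r - gridRep β S n (a + Z r) ∈ ball β (-(n : ℤ)) := fun r =>
    (gridRep_spec hβ hS (add_mem_ball hβ ha ((ballSubgroup hβ n).sum_mem fun l _ => hz l))).2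
  have hsum : ∑ l, (if u l ∈ Set.Ioc (s : ℝ) s' then z l else 0) = Z s' - Z s := by
    simp only [Z, Finset.sum_filter, ← Finset.sum_sub_distrib]
    refine Finset.sum_congr rfl fun l _ => ?_
    by_cases hl : u l ≤ s
    · simp [hl, hl.trans hs, hl.not_gt]
    · simp [hl, lt_of_not_ge hl]
  rw [hpath, hpath, hsum]
  convert sub_mem_ball hβ (hrep s) (hrep s') using 1
  ring

theorem incrementChar_jumpPath (hβ : IsUniformizer β) (hS : IsRepSystem S)
    (hχ : IsRankZeroChar β χ) {a : K} (ha : a ∈ ball β (n : ℤ)) {z : Fin k → K}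
    (hz : ∀ l, z l ∈ ball β (n : ℤ)) {y : Fin N → K} (hy : ∀ i, y i ∈ ball β (n : ℤ))
    {u : Fin k → ℝ} (hu : ∀ l, u l < t) {σ : Fin (N + 1) → Set.Icc (0 : ℝ) t} (hσ : Monotone σ) :
    incrementChar χ σ y (jumpPath β S n a t z u) =
      ∏ l, ∏ i, if u l ∈ Set.Ioc (σ i.castSucc : ℝ) (σ i.succ) then (χ (-(z l * y i)) : ℂ)
        else 1 := by
  rw [Finset.prod_comm, incrementChar]
  refine Finset.prod_congr rfl fun i _ => ?_
  have hone := char_mul_eq_one hβ hχ (jumpPath_increment_sub_sum_mem_ball hβ hS ha hz hu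
    (hσ (Fin.castSucc_lt_succ (i := i)).le)) ((neg_neg (n : ℤ)).symm ▸ hy i)
  rw [sub_mul, AddChar.map_sub_eq_div, div_eq_one, Finset.sum_mul, addChar_sum] at hone
  rw [AddChar.map_neg_eq_inv, hone, ← Finset.prod_inv_distrib]
  refine (map_prod Circle.coeHom _ _).trans (Finset.prod_congr rfl fun l _ => ?_)
  split_ifs
  · exact congrArg Circle.coeHom (AddChar.map_neg_eq_inv _ _).symm
  · rw [zero_mul, AddChar.map_zero_eq_one, inv_one, map_one]

end JumpPath

section WalkMeasure

variable {K : Type*} [Field K] [ValuativeRel K] [TopologicalSpace K] [IsNonarchimedeanLocalField K]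
  {β : 𝒪[K]} {S : Finset 𝒪[K]} {χ : AddChar K Circle} {α t : ℝ} {n k N : ℕ} {a : K}

/-- The law of the path started at `a` that makes `k` jumps at independent uniform times, with
jumps drawn independently according to `jumpRate`. It is not normalised: times have total mass `t`
and jumps the total jump rate. -/
def jumpMeasure (β : 𝒪[K]) (S : Finset 𝒪[K]) (χ : AddChar K Circle) (α : ℝ) (n : ℕ) (a : K) (t : ℝ)
    (k : ℕ) : Measure (SkorokhodSpace K t) :=
  ∑ z ∈ Fintype.piFinset fun _ : Fin k => grid β S n,
    (∏ l, jumpRate β S χ α n (z l)) •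
      (Measure.pi fun _ => volume.restrict (Set.Ioo 0 t)).map (jumpPath β S n a t z)

/-- The law of the compound Poisson process on the grid started at `a`: given that there are `k`
jumps, a Poisson distributed number, the path is distributed according to `jumpMeasure`. -/
def walkMeasure (β : 𝒪[K]) (S : Finset 𝒪[K]) (χ : AddChar K Circle) (α : ℝ) (n : ℕ) (a : K)
    (t : ℝ) : Measure (SkorokhodSpace K t) :=
  Measure.sum fun k =>
    (Real.exp (-((∑ z ∈ grid β S n, jumpRate β S χ α n z : NNReal) * t)) / k.factorial).toNNReal •
      jumpMeasure β S χ α n a t k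

theorem aemeasurable_jumpPath (ht : 0 < t) (z : Fin k → K) :
    AEMeasurable (jumpPath β S n a t z) (Measure.pi fun _ => volume.restrict (Set.Ioo 0 t)) :=
  aemeasurable_stepPath _ ht

instance isFiniteMeasure_jumpMeasure : IsFiniteMeasure (jumpMeasure β S χ α n a t k) := by
  unfold jumpMeasure
  infer_instance

theorem ae_pi_Ioo (t : ℝ) (k : ℕ) :
    ∀ᵐ u ∂Measure.pi fun _ : Fin k => volume.restrict (Set.Ioo 0 t), ∀ l, u l ∈ Set.Ioo 0 t := by
  rw [← Measure.restrict_pi_pi]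
  exact (ae_restrict_mem (.univ_pi fun _ => measurableSet_Ioo)).mono fun u hu l => hu l trivial

theorem integral_incrementChar_map_jumpPath (hβ : IsUniformizer β) (hS : IsRepSystem S)
    (hχ : IsRankZeroChar β χ) (ht : 0 < t) (ha : a ∈ ball β (n : ℤ)) {z : Fin k → K}
    (hz : ∀ l, z l ∈ ball β (n : ℤ)) {y : Fin N → K} (hy : ∀ i, y i ∈ ball β (n : ℤ))
    {σ : Fin (N + 1) → Set.Icc (0 : ℝ) t} (hσ : Monotone σ) :
    ∫ ω, incrementChar χ σ y ω
        ∂(Measure.pi fun _ => volume.restrict (Set.Ioo 0 t)).map (jumpPath β S n a t z) =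
      ∏ l, (t + ∑ i, (((σ i.succ : ℝ) - σ i.castSucc : ℝ) : ℂ) * (χ (-(z l * y i)) - 1)) := by
  rw [integral_map (aemeasurable_jumpPath ht z)
    (measurable_incrementChar hβ hχ σ y).aestronglyMeasurable]
  rw [integral_congr_ae ((ae_pi_Ioo t k).mono fun u hu =>
    incrementChar_jumpPath hβ hS hχ ha hz hy (fun l => (hu l).2) hσ),
    integral_fintype_prod_eq_prod (μ := fun _ => volume.restrict (Set.Ioo 0 t)) fun l (v : ℝ) =>
      ∏ i, if v ∈ Set.Ioc (σ i.castSucc : ℝ) (σ i.succ) then (χ (-(z l * y i)) : ℂ) else 1]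
  exact Finset.prod_congr rfl fun l _ => integral_Ioo_prod_ite_mem_Ioc hσ _

theorem integral_incrementChar_jumpMeasure (hβ : IsUniformizer β) (hS : IsRepSystem S)
    (hχ : IsRankZeroChar β χ) (hα : 0 < α) (h0 : (0 : K) ∈ grid β S n) (ht : 0 < t)
    (ha : a ∈ ball β (n : ℤ)) {y : Fin N → K} (hy : ∀ i, y i ∈ grid β S n)
    {σ : Fin (N + 1) → Set.Icc (0 : ℝ) t} (hσ : Monotone σ) :
    ∫ ω, incrementChar χ σ y ω ∂jumpMeasure β S χ α n a t k =
      (((∑ z ∈ grid β S n, jumpRate β S χ α n z : NNReal) * t -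
        ∑ i, ((σ i.succ : ℝ) - σ i.castSucc) * canonAbs (y i) ^ α : ℝ) : ℂ) ^ k := by
  have hsum : ∑ z ∈ grid β S n, (jumpRate β S χ α n z : ℂ) *
      (t + ∑ i, (((σ i.succ : ℝ) - σ i.castSucc : ℝ) : ℂ) * (χ (-(z * y i)) - 1)) =
      (((∑ z ∈ grid β S n, jumpRate β S χ α n z : NNReal) * t -
        ∑ i, ((σ i.succ : ℝ) - σ i.castSucc) * canonAbs (y i) ^ α : ℝ) : ℂ) := by
    simp only [mul_add, Finset.sum_add_distrib, Finset.mul_sum, ← Finset.sum_mul]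
    rw [Finset.sum_comm]
    simp only [mul_left_comm _ (((σ _ : ℝ) - σ _ : ℝ) : ℂ), ← Finset.mul_sum]
    rw [Finset.sum_congr rfl fun i _ => congrArg _
      (sum_jumpRate_mul_char_sub_one hβ hS hχ hα h0 (hy i))]
    push_cast
    simp only [mul_neg, Finset.sum_neg_distrib, sub_eq_add_neg]
  have hprod := Finset.prod_univ_sum (fun _ : Fin k => grid β S n) fun _ z =>
    (jumpRate β S χ α n z : ℂ) *
      (t + ∑ i, (((σ i.succ : ℝ) - σ i.castSucc : ℝ) : ℂ) * (χ (-(z * y i)) - 1))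
  rw [Finset.prod_const, Finset.card_univ, Fintype.card_fin, hsum] at hprod
  rw [hprod, jumpMeasure, integral_finsetSum_measure fun z _ =>
    integrable_incrementChar hβ hχ σ y _]
  refine Finset.sum_congr rfl fun z hz => ?_
  have hz' := Fintype.mem_piFinset.1 hz
  rw [integral_smul_nnreal_measure, integral_incrementChar_map_jumpPath hβ hS hχ ht ha
    (fun l => grid_subset_ball hβ (hz' l)) (fun i => grid_subset_ball hβ (hy i)) hσ,
    Finset.prod_mul_distrib, NNReal.smul_def, NNReal.coe_prod, Complex.real_smul,
    Complex.ofReal_prod]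

theorem jumpMeasure_univ (hβ : IsUniformizer β) (hS : IsRepSystem S)
    (hχ : IsRankZeroChar β χ) (hα : 0 < α) (h0 : (0 : K) ∈ grid β S n) (ht : 0 < t)
    (ha : a ∈ ball β (n : ℤ)) :
    jumpMeasure β S χ α n a t k Set.univ =
      ENNReal.ofReal (((∑ z ∈ grid β S n, jumpRate β S χ α n z : NNReal) * t) ^ k) := by
  have hint := integral_incrementChar_jumpMeasure (k := k) (N := 0) (y := Fin.elim0)
    (σ := fun _ => ⟨0, le_rfl, ht.le⟩) hβ hS hχ hα h0 ht ha (fun i => i.elim0) monotone_const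
  simp only [incrementChar, Finset.univ_eq_empty, Finset.prod_empty, Finset.sum_empty, sub_zero,
    integral_const, Complex.real_smul, mul_one, ← Complex.ofReal_pow, Complex.ofReal_inj] at hint
  rw [← hint, ofReal_measureReal]

theorem isProbabilityMeasure_walkMeasure (hβ : IsUniformizer β) (hS : IsRepSystem S)
    (hχ : IsRankZeroChar β χ) (hα : 0 < α) (h0 : (0 : K) ∈ grid β S n) (ht : 0 < t)
    (ha : a ∈ ball β (n : ℤ)) : IsProbabilityMeasure (walkMeasure β S χ α n a t) := by
  constructor
  set Λ := ((∑ z ∈ grid β S n, jumpRate β S χ α n z : NNReal) : ℝ) * t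
  have : 0 ≤ Λ := mul_nonneg (NNReal.coe_nonneg _) ht.le
  have hsum : HasSum (fun k : ℕ => Real.exp (-Λ) / k.factorial * Λ ^ k) 1 := by
    have hexp := (NormedSpace.expSeries_div_hasSum_exp (𝔸 := ℝ) Λ).mul_left (Real.exp (-Λ))
    rw [← Real.exp_eq_exp_ℝ, ← Real.exp_add, neg_add_cancel, Real.exp_zero] at hexp
    simpa only [mul_div_assoc', div_mul_eq_mul_div] using hexp
  rw [walkMeasure, Measure.sum_apply _ .univ, ← ENNReal.ofReal_one, ← hsum.tsum_eq,
    ENNReal.ofReal_tsum_of_nonneg (fun k => by positivity) hsum.summable]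
  refine tsum_congr fun k => ?_
  rw [Measure.smul_apply, jumpMeasure_univ hβ hS hχ hα h0 ht ha, ENNReal.ofReal_mul (by positivity)]
  rfl

theorem integral_incrementChar_walkMeasure (hβ : IsUniformizer β) (hS : IsRepSystem S)
    (hχ : IsRankZeroChar β χ) (hα : 0 < α) (h0 : (0 : K) ∈ grid β S n) (ht : 0 < t)
    (ha : a ∈ ball β (n : ℤ)) {y : Fin N → K} (hy : ∀ i, y i ∈ grid β S n)
    {σ : Fin (N + 1) → Set.Icc (0 : ℝ) t} (hσ : Monotone σ) :
    ∫ ω, incrementChar χ σ y ω ∂walkMeasure β S χ α n a t =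
      ∏ i, (Real.exp (-((σ i.succ : ℝ) - σ i.castSucc) * canonAbs (y i) ^ α) : ℂ) := by
  have := isProbabilityMeasure_walkMeasure hβ hS hχ hα h0 ht ha
  set Λ := ((∑ z ∈ grid β S n, jumpRate β S χ α n z : NNReal) : ℝ) * t with hΛ
  set c := ∑ i, ((σ i.succ : ℝ) - σ i.castSucc) * canonAbs (y i) ^ α with hc
  have hsum := hasSum_integral_measure
    (integrable_incrementChar hβ hχ σ y (walkMeasure β S χ α n a t))
  have hexp := (NormedSpace.expSeries_div_hasSum_exp (𝔸 := ℝ) (Λ - c)).mul_left (Real.exp (-Λ))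
  rw [← Real.exp_eq_exp_ℝ, ← Real.exp_add, neg_add_eq_sub, sub_sub_cancel_left, hc,
    ← Finset.sum_neg_distrib, Real.exp_sum, ← Complex.hasSum_ofReal] at hexp
  simp only [neg_mul, ← Complex.ofReal_prod]
  refine hsum.unique ?_
  suffices h : ∀ k : ℕ, ∫ ω, incrementChar χ σ y ω
      ∂(Real.exp (-Λ) / k.factorial).toNNReal • jumpMeasure β S χ α n a t k =
        (Real.exp (-Λ) * ((Λ - c) ^ k / k.factorial) : ℝ) from (funext h).symm ▸ hexp
  intro k
  rw [integral_smul_nnreal_measure, integral_incrementChar_jumpMeasure hβ hS hχ hα h0 ht ha hy hσ,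
    NNReal.smul_def, Real.coe_toNNReal _ (by positivity), Complex.real_smul,
    ← hΛ, ← hc]
  push_cast
  ring

theorem ae_walkMeasure (ht : 0 < t) {p : SkorokhodSpace K t → Prop} (hp : MeasurableSet {ω | p ω})
    (h : ∀ k (z : Fin k → K) (u : Fin k → ℝ), (∀ l, z l ∈ grid β S n) → (∀ l, 0 < u l) →
      p (jumpPath β S n a t z u)) :
    ∀ᵐ ω ∂walkMeasure β S χ α n a t, p ω := by
  refine (Measure.ae_sum_iff' hp).2 fun k => Measure.ae_smul_measure ?_ _
  rw [ae_iff, jumpMeasure, Measure.finsetSum_apply, Finset.sum_eq_zero_iff]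
  intro z hz
  refine ae_iff.1 (Measure.ae_smul_measure ((ae_map_iff (aemeasurable_jumpPath ht z) hp).2 ?_) _)
  exact (ae_pi_Ioo t k).mono fun u hu => h k z u (Fintype.mem_piFinset.1 hz) fun l => (hu l).1

end WalkMeasure

section FiniteDimensional

variable {K : Type*} [Field K] [ValuativeRel K] [TopologicalSpace K] [IsNonarchimedeanLocalField K]
  {β : 𝒪[K]} {S : Finset 𝒪[K]} {χ : AddChar K Circle} {α t : ℝ} {n N : ℕ} {a : K}

theorem forall_succ_mem_iff {G : Type*} [AddCommGroup G] (H : AddSubgroup G)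
    {e : Fin (N + 1) → G} (h0 : e 0 ∈ H) :
    (∀ i : Fin N, e i.succ ∈ H) ↔ ∀ i : Fin N, e i.succ - e i.castSucc ∈ H := by
  constructor
  · intro h i
    have hall : ∀ j, e j ∈ H := Fin.cases h0 h
    exact H.sub_mem (hall _) (hall _)
  · intro h i
    have hall : ∀ j, e j ∈ H := fun j => by
      induction j using Fin.induction with
      | zero => exact h0
      | succ i ih => simpa only [sub_add_cancel] using H.add_mem (h i) ih
    exact hall _

open Classical in
theorem ite_forall_sub_mem_ball_eq_sum (hβ : IsUniformizer β) (hS : IsRepSystem S)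
    (hχ : IsRankZeroChar β χ) {x d : Fin N → K} (h : ∀ i, x i - d i ∈ ball β (n : ℤ)) :
    (if ∀ i, x i - d i ∈ ball β (-(n : ℤ)) then (1 : ℂ) else 0) =
      ((resCard K : ℂ) ^ (2 * n * N))⁻¹ * ∑ y ∈ Fintype.piFinset fun _ => grid β S n,
        (∏ i, (χ (-(d i * y i)) : ℂ)) * ∏ i, (χ (x i * y i) : ℂ) := by
  have hsplit : ∀ (y : Fin N → K), (∏ i, (χ (-(d i * y i)) : ℂ)) * ∏ i, (χ (x i * y i) : ℂ) =
      ∏ i, (χ ((x i - d i) * y i) : ℂ) := fun y => by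
    rw [← Finset.prod_mul_distrib]
    refine Finset.prod_congr rfl fun i _ => ?_
    rw [← Circle.coe_mul, ← AddChar.map_add_eq_mul, sub_mul, neg_add_eq_sub]
  simp only [hsplit]
  rw [← Finset.prod_univ_sum (fun _ => grid β S n) fun i y => (χ ((x i - d i) * y) : ℂ),
    Finset.prod_congr rfl fun i _ => sum_grid_char_mul hβ hS hχ (h i), Fintype.prod_ite_zero,
    Finset.prod_const, Finset.card_univ, Fintype.card_fin, ← pow_mul, mul_ite, mul_zero,
    inv_mul_cancel₀ (pow_ne_zero _ resCard_ne_zero)]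
  congr

theorem prod_density_eq_sum (s : Fin N → ℝ) (x : Fin N → K) :
    ∏ i, density β S χ α n (s i) (x i) =
      ((resCard K : ℂ) ^ (n * N))⁻¹ * ∑ y ∈ Fintype.piFinset fun _ => grid β S n,
        (∏ i, (Real.exp (-s i * canonAbs (y i) ^ α) : ℂ)) * ∏ i, (χ (x i * y i) : ℂ) := by
  simp only [density, invFourier, Finset.prod_mul_distrib, Finset.prod_const, Finset.card_univ,
    Fintype.card_fin, Finset.prod_univ_sum, inv_pow, ← pow_mul]

theorem forall_path_eq_iff (hβ : IsUniformizer β) (hS : IsRepSystem S)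
    {ω : SkorokhodSpace K t} {σ : Fin (N + 1) → Set.Icc (0 : ℝ) t} {b : Fin (N + 1) → K}
    (hω : ∀ j, ω.path (σ j) ∈ grid β S n) (hb : ∀ j, b j ∈ grid β S n) (h0 : ω.path (σ 0) = b 0) :
    (∀ i : Fin N, ω.path (σ i.succ) = b i.succ) ↔ ∀ i : Fin N, (b i.succ - b i.castSucc) -
      (ω.path (σ i.succ) - ω.path (σ i.castSucc)) ∈ ball β (-(n : ℤ)) := by
  have heq : ∀ j, ω.path (σ j) = b j ↔ b j - ω.path (σ j) ∈ ballSubgroup hβ (-(n : ℤ)) := fun j =>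
    ⟨fun h => by rw [h, sub_self]; exact zero_mem _,
      fun h => (eq_of_sub_mem_ball hβ hS (hb j) (hω j) h).symm⟩
  simp only [heq]
  rw [forall_succ_mem_iff (e := fun j => b j - ω.path (σ j)) _ ((heq 0).1 h0)]
  simp only [sub_sub_sub_comm]
  rfl

theorem ae_walkMeasure_path_mem_grid (hβ : IsUniformizer β) (hS : IsRepSystem S) (ht : 0 < t)
    (ha : a ∈ ball β (n : ℤ)) (s : Set.Icc (0 : ℝ) t) :
    ∀ᵐ ω ∂walkMeasure β S χ α n a t, ω.path s ∈ grid β S n :=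
  ae_walkMeasure ht (measurableSet_setOf_path_mem_finset hβ s _) fun _ _ u hz _ =>
    jumpPath_path_mem_grid hβ hS ha (fun l => grid_subset_ball hβ (hz l)) u s

theorem ae_walkMeasure_path_zero (hβ : IsUniformizer β) (hS : IsRepSystem S) (ht : 0 < t)
    (ha : a ∈ grid β S n) {s : Set.Icc (0 : ℝ) t} (hs : (s : ℝ) = 0) :
    ∀ᵐ ω ∂walkMeasure β S χ α n a t, ω.path s = a :=
  ae_walkMeasure ht (measurableSet_setOf_path_eq hβ s a) fun _ z _ _ hu =>
    jumpPath_path_zero hβ hS ha z hu hs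

theorem measurableSet_setOf_forall_path_eq (hβ : IsUniformizer β) (τ : Fin N → Set.Icc (0 : ℝ) t)
    (b : Fin N → K) : MeasurableSet {ω : SkorokhodSpace K t | ∀ i, ω.path (τ i) = b i} := by
  simp only [Set.ofPred_forall]
  exact .iInter fun i => measurableSet_setOf_path_eq hβ (τ i) (b i)

open Classical in
theorem ae_walkMeasure_indicator_eq_sum (hβ : IsUniformizer β) (hS : IsRepSystem S)
    (hχ : IsRankZeroChar β χ) (ht : 0 < t) {σ : Fin (N + 1) → Set.Icc (0 : ℝ) t}
    (hσ0 : (σ 0 : ℝ) = 0) {b : Fin (N + 1) → K} (hb : ∀ j, b j ∈ grid β S n) :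
    ∀ᵐ ω ∂walkMeasure β S χ α n (b 0) t,
      {ω : SkorokhodSpace K t | ∀ i : Fin N, ω.path (σ i.succ) = b i.succ}.indicator 1 ω =
        ((resCard K : ℂ) ^ (2 * n * N))⁻¹ * ∑ y ∈ Fintype.piFinset fun _ => grid β S n,
          incrementChar χ σ y ω * ∏ i, (χ ((b i.succ - b i.castSucc) * y i) : ℂ) := by
  have hball : ∀ {x y : K}, x ∈ grid β S n → y ∈ grid β S n → x - y ∈ ball β (n : ℤ) :=
    fun hx hy => sub_mem_ball hβ (grid_subset_ball hβ hx) (grid_subset_ball hβ hy)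
  filter_upwards [ae_all_iff.2 fun j =>
      ae_walkMeasure_path_mem_grid hβ hS ht (grid_subset_ball hβ (hb 0)) (σ j),
    ae_walkMeasure_path_zero hβ hS ht (hb 0) hσ0] with ω hω hω0
  refine (Set.indicator_apply _ _ _).trans
    ((if_congr (forall_path_eq_iff hβ hS hω hb hω0) rfl rfl).trans ?_)
  exact ite_forall_sub_mem_ball_eq_sum hβ hS hχ fun i =>
    sub_mem_ball hβ (hball (hb _) (hb _)) (hball (hω _) (hω _))

theorem measureReal_walkMeasure_setOf_forall_path_eq (hβ : IsUniformizer β) (hS : IsRepSystem S)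
    (hχ : IsRankZeroChar β χ) (hα : 0 < α) (h0 : (0 : K) ∈ grid β S n) (ht : 0 < t)
    {σ : Fin (N + 1) → Set.Icc (0 : ℝ) t} (hσ : Monotone σ) (hσ0 : (σ 0 : ℝ) = 0)
    {b : Fin (N + 1) → K} (hb : ∀ j, b j ∈ grid β S n) :
    ((walkMeasure β S χ α n (b 0) t).real {ω | ∀ i : Fin N, ω.path (σ i.succ) = b i.succ} : ℂ) =
      (∏ i : Fin N, density β S χ α n ((σ i.succ : ℝ) - σ i.castSucc) (b i.succ - b i.castSucc)) *
        ((resCard K : ℂ) ^ (n * N))⁻¹ := by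
  classical
  have hb0 := grid_subset_ball hβ (hb 0)
  have := isProbabilityMeasure_walkMeasure hβ hS hχ hα h0 ht hb0
  set A := {ω : SkorokhodSpace K t | ∀ i : Fin N, ω.path (σ i.succ) = b i.succ}
  have hA : MeasurableSet A :=
    measurableSet_setOf_forall_path_eq hβ (fun i => σ i.succ) fun i => b i.succ
  have hpow : ((resCard K : ℂ) ^ (2 * n * N))⁻¹ =
      ((resCard K : ℂ) ^ (n * N))⁻¹ * ((resCard K : ℂ) ^ (n * N))⁻¹ := by
    rw [← mul_inv, ← pow_add, ← two_mul, mul_assoc]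
  calc ((walkMeasure β S χ α n (b 0) t).real A : ℂ)
      = ∫ ω, A.indicator 1 ω ∂walkMeasure β S χ α n (b 0) t := by
        rw [Pi.one_def, integral_indicator_const (1 : ℂ) hA, Complex.real_smul, mul_one]
    _ = ((resCard K : ℂ) ^ (2 * n * N))⁻¹ * ∑ y ∈ Fintype.piFinset fun _ => grid β S n,
          (∏ i : Fin N, (Real.exp (-((σ i.succ : ℝ) - σ i.castSucc) * canonAbs (y i) ^ α) : ℂ)) *
            ∏ i, (χ ((b i.succ - b i.castSucc) * y i) : ℂ) := by
        rw [integral_congr_ae (ae_walkMeasure_indicator_eq_sum hβ hS hχ ht hσ0 hb),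
          integral_const_mul, integral_finsetSum _ fun y _ =>
            (integrable_incrementChar hβ hχ σ y _).mul_const _]
        refine congrArg _ (Finset.sum_congr rfl fun y hy => ?_)
        rw [integral_mul_const, integral_incrementChar_walkMeasure hβ hS hχ hα h0 ht hb0
          (Fintype.mem_piFinset.1 hy) hσ]
    _ = _ := by rw [prod_density_eq_sum, hpow, mul_right_comm, mul_assoc]

end FiniteDimensional

section GridWalkMeasure

variable {K : Type*} [Field K] [ValuativeRel K] [TopologicalSpace K] [IsNonarchimedeanLocalField K]
  {β : 𝒪[K]} {S : Finset 𝒪[K]} {χ : AddChar K Circle} {α t : ℝ} {n N : ℕ} {a : K}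

theorem monotone_cons {ι : Type*} [Preorder ι] {x : ι} {f : Fin N → ι} (hx : ∀ i, x ≤ f i)
    (hf : Monotone f) : Monotone (Fin.cons x f : Fin (N + 1) → ι) := by
  intro i j hij
  induction i using Fin.cases with
  | zero => exact Fin.cases (motive := fun j => x ≤ (Fin.cons x f : Fin (N + 1) → ι) j) le_rfl hx j
  | succ i =>
    induction j using Fin.cases with
    | zero => exact absurd hij (Fin.succ_pos i).not_ge
    | succ j => exact hf (Fin.succ_le_succ_iff.1 hij)

open Classical in
theorem measureReal_setOf_forall_path_mem_eq_sum (hβ : IsUniformizer β) {F : Finset K}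
    {P : Measure (SkorokhodSpace K t)} [IsFiniteMeasure P] {τ : Fin N → Set.Icc (0 : ℝ) t}
    (hF : ∀ i, ∀ᵐ ω ∂P, ω.path (τ i) ∈ F) (J : Fin N → Set K) :
    P.real {ω | ∀ i, ω.path (τ i) ∈ J i} =
      ∑ b ∈ Fintype.piFinset fun _ => F with ∀ i, b i ∈ J i,
        P.real {ω | ∀ i, ω.path (τ i) = b i} := by
  rw [← measureReal_biUnion_finset (fun b _ b' _ hbb' => Set.disjoint_left.2 fun ω h h' =>
      hbb' (funext fun i => (h i).symm.trans (h' i)))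
    (fun b _ => measurableSet_setOf_forall_path_eq hβ τ b)]
  refine measureReal_congr (eventuallyEq_set.2 ?_)
  filter_upwards [ae_all_iff.2 hF] with ω hω
  simp only [Set.mem_iUnion, Set.mem_ofPred_eq, ← funext_iff, exists_prop, exists_eq_right',
    Finset.mem_filter, Fintype.mem_piFinset, and_iff_right hω]

theorem isGridWalkMeasure_walkMeasure (hβ : IsUniformizer β) (hS : IsRepSystem S)
    (hχ : IsRankZeroChar β χ) (hα : 0 < α) (h0 : (0 : K) ∈ grid β S n) (ht : 0 < t)
    (ha : a ∈ grid β S n) : IsGridWalkMeasure β S χ α n a (walkMeasure β S χ α n a t) := by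
  classical
  have ha' := grid_subset_ball hβ ha
  have hprob := isProbabilityMeasure_walkMeasure hβ hS hχ hα h0 ht ha'
  refine ⟨hprob, fun N τ hτ J _ => ?_⟩
  set σ : Fin (N + 1) → Set.Icc (0 : ℝ) t := Fin.cons ⟨0, le_rfl, ht.le⟩ τ
  have hσ : Monotone σ := monotone_cons (fun i => (τ i).2.1) hτ.monotone
  have hσ_coe : ∀ j, (Fin.cons 0 fun i => (τ i : ℝ) : Fin (N + 1) → ℝ) j = σ j :=
    Fin.cases rfl fun _ => rfl
  rw [measureReal_setOf_forall_path_mem_eq_sum hβ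
    (fun i => ae_walkMeasure_path_mem_grid hβ hS ht ha' (τ i)), Complex.ofReal_sum, cylinderMass]
  refine Finset.sum_congr (by congr) fun b hb => ?_
  have hb' : ∀ j, (Fin.cons a b : Fin (N + 1) → K) j ∈ grid β S n :=
    Fin.cases ha (Fintype.mem_piFinset.1 (Finset.mem_filter.1 hb).1)
  have h := measureReal_walkMeasure_setOf_forall_path_eq hβ hS hχ hα h0 ht hσ rfl hb'
  simp only [hσ_coe]
  simp only [σ, Fin.cons_zero, Fin.cons_succ] at h ⊢
  exact h

theorem cylinderMass_eq_zero (τ : Fin N → ℝ) {J : Fin N → Set K} (i : Fin N)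
    (hJ : Disjoint (J i) (grid β S n)) : cylinderMass β S χ α n a τ J = 0 := by
  classical
  refine Finset.sum_eq_zero fun b hb => ?_
  rw [Finset.mem_filter, Fintype.mem_piFinset] at hb
  exact absurd (hb.1 i) (Set.disjoint_left.1 hJ (hb.2 i))

theorem IsGridWalkMeasure.ae_path_mem_grid (hβ : IsUniformizer β)
    {P : Measure (SkorokhodSpace K t)} (hP : IsGridWalkMeasure β S χ α n a P)
    (s : Set.Icc (0 : ℝ) t) : ∀ᵐ ω ∂P, ω.path s ∈ grid β S n := by
  have := hP.isProb
  have := t1Space_of_isUniformizer hβ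
  have h := hP.cylinder 1 (fun _ => s) (Subsingleton.strictMono _) (fun _ => (grid β S n : Set K)ᶜ)
    fun _ => MeasurableSpace.measurableSet_generateFrom (grid β S n).isClosed.isOpen_compl
  rw [cylinderMass_eq_zero _ 0 disjoint_compl_left, Complex.ofReal_eq_zero,
    measureReal_eq_zero_iff] at h
  simpa only [ae_iff, Set.mem_compl_iff, Finset.mem_coe, forall_const] using h

theorem SkorokhodSpace.forall_mem_of_dense {X : Type*} [TopologicalSpace X]
    (ω : SkorokhodSpace X t) {F : Set X} (hF : IsClosed F) {D : Set (Set.Icc (0 : ℝ) t)}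
    (hD : Dense D) (htop : ∀ s, IsTop s → s ∈ D) (hω : ∀ s ∈ D, ω.path s ∈ F)
    (s : Set.Icc (0 : ℝ) t) : ω.path s ∈ F := by
  by_cases hs : IsTop s
  · exact hω s (htop s hs)
  obtain ⟨e, hse⟩ := not_forall.1 hs
  refine hF.mem_of_frequently_of_tendsto (frequently_iff.2 fun hV => ?_) (ω.rightCont s)
  obtain ⟨v, hv, hsub⟩ := (mem_nhdsGT_iff_exists_Ioo_subset' (not_le.1 hse)).1 hV
  obtain ⟨r, hrD, hr⟩ := hD.exists_between hv
  exact ⟨r, hsub hr, hω r hrD⟩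

theorem IsGridWalkMeasure.measure_forall_mem_grid (hβ : IsUniformizer β)
    {P : Measure (SkorokhodSpace K t)} (hP : IsGridWalkMeasure β S χ α n a P) :
    P {ω | ∀ s, ω.path s ∈ grid β S n} = 1 := by
  have := hP.isProb
  have := t1Space_of_isUniformizer hβ
  obtain ⟨D, hDc, hD, -, htop⟩ := exists_countable_dense_bot_top (Set.Icc (0 : ℝ) t)
  have hae : ∀ᵐ ω ∂P, ∀ s, ω.path s ∈ grid β S n := by
    filter_upwards [(ae_ball_iff hDc).2 fun s _ => hP.ae_path_mem_grid hβ s] with ω hω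
    exact ω.forall_mem_of_dense (grid β S n).isClosed hD htop hω
  rw [measure_congr (eventuallyEq_univ.2 hae), measure_univ]

end GridWalkMeasure

end LocalFieldWalk

end

theorem mainTheorem12 {K : Type*} [Field K] [ValuativeRel K] [TopologicalSpace K]
    [IsNonarchimedeanLocalField K]
    (β : 𝒪[K]) (hβ : LocalFieldWalk.IsUniformizer β)
    (S : Finset 𝒪[K]) (hS : LocalFieldWalk.IsRepSystem S)
    (χ : AddChar K Circle) (hχ : LocalFieldWalk.IsRankZeroChar β χ)
    (α : ℝ) (hα : 0 < α) (t : ℝ) (ht : 0 < t) (n : ℕ) (hn : 0 < n)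
    (h0 : (0 : K) ∈ LocalFieldWalk.grid β S n)
    (a : K) (ha : a ∈ LocalFieldWalk.grid β S n) :
    (∃ P : MeasureTheory.Measure (LocalFieldWalk.SkorokhodSpace K t),
      LocalFieldWalk.IsGridWalkMeasure β S χ α n a P) ∧
    ∀ P : MeasureTheory.Measure (LocalFieldWalk.SkorokhodSpace K t),
      LocalFieldWalk.IsGridWalkMeasure β S χ α n a P →
        P {ω | ∀ s, ω.path s ∈ LocalFieldWalk.grid β S n} = 1 :=
  ⟨⟨_, LocalFieldWalk.isGridWalkMeasure_walkMeasure hβ hS hχ hα h0 ht ha⟩,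
    fun _ hP => hP.measure_forall_mem_grid hβ⟩
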